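/- Let $n\ge 2$, $\sigma>0$, $\theta_0\in\mathbb R^n$, and consider the linear regression model $y(t)=\phi(t)^T\theta_0+v(t)$, $t=1,2,\dots$, where $v(1),v(2),\dots$ are independent $\mathcal N(0,\sigma^2)$ random variables and the regressors $\phi(t)\in\mathbb R^n$ are random vectors (possibly deterministic) such that the sequence $(\phi(t))_t$ is independent of the sequence $(v(t))_t$. For sample size $N$ let $\Phi\in\mathbb R^{N\times n}$ have rows $\phi(1)^T,\dots,\phi(N)^T$ and let $Y=(y(1),\dots,y(N))^T$. Suppose that, as $N\to\infty$, $\Phi^T\Phi/N\to\Sigma$ almost surely, with $\Sigma$ positive definite. Let $P=P(\eta)=\eta I_n$ (ridge regression) with $\eta$ in an open set $\Omega\subset(0,\infty)$, and put $Q=\Phi P\Phi^T+\sigma^2 I_N$ and $\hat\theta^{R}=P\Phi^TQ^{-1}Y$. Let $\hat\eta_{EB}$ and $\hat\eta_{Sy}$ be random variables (depending on $N$) which, with probability tending to $1$ as $N\to\infty$, are minimizers over $\Omega$ of, respectively, $$\mathcal F_{EB}(\eta)=Y^TQ^{-1}Y+\log\det Q,\qquad \mathcal F_{Sy}(\eta)=\|Y-\Phi\hat\theta^{R}\|_2^2+2\sigma^2\operatorname{Tr}(\Phi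 P\Phi^TQ^{-1}).$$ Let $\eta_b^*\in\Omega$ and $\eta_y^*\in\Omega$ be minimizers over $\Omega$ of, respectively, $$W_b(\eta)=\theta_0^TP^{-1}\theta_0+\log\det P,\qquad W_y(\eta)=\sigma^4\theta_0^TP^{-T}\Sigma^{-1}P^{-1}\theta_0-2\sigma^4\operatorname{Tr}(\Sigma^{-1}P^{-1}).$$ 1. As $N\to\infty$, $$\sqrt N(\hat\eta_{EB}-\eta_b^*)\overset{d}{\to}\mathcal N\Big(0,\frac{4\sigma^2}{n^2}\theta_0^T\Sigma^{-1}\theta_0\Big).$$ 2. Suppose moreover that $\|\Phi^T\Phi/N-\Sigma\|_F=O_p(\delta_N)$ for a sequence $\delta_N>0$ with $\delta_N=o(1/\sqrt N)$, where $\xi_N=O_p(\delta_N)$ means that for every $\epsilon>0$ there is $L>0$ with $\Pr(|\xi_N/\delta_N|>L)<\epsilon$ for all $N\geq 1$. Then, as $N\to\infty$, $$\sqrt N(\hat\eta_{Sy}-\eta_y^*)\overset{d}{\to}\mathcal N\Big(0,\frac{4\sigma^2}{\operatorname{Tr}(\Sigma^{-1})^2}\theta_0^T\Sigma^{-3}\theta_0\Big).$$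 3. Write $\lambda_1(\cdot)\ge\dots\ge\lambda_n(\cdot)$ for the eigenvalues of a symmetric matrix. Let the positive definite matrix $\Sigma$ vary along a sequence such that $\lambda_n(\Sigma)\to0$ while $\lambda_1(\Sigma),\dots,\lambda_{n-1}(\Sigma)$ are fixed, and suppose that there are unit eigenvectors $u_n$ of $\Sigma$ for $\lambda_n(\Sigma)$ with $|u_n^T\theta_0|$ bounded away from $0$ along the sequence (for fixed eigenvectors: $u_n^T\theta_0\neq0$). Then $\lambda_1(\Sigma)/\lambda_n(\Sigma)\to\infty$, and the ratio of the asymptotic variance in 1 to that in 2 satisfies $$\frac{\theta_0^T\Sigma^{-1}\theta_0/n^2}{\theta_0^T\Sigma^{-3}\theta_0/\operatorname{Tr}(\Sigma^{-1})^2}\to\frac1{n^2}.$$ -/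

import Mathlib

open Filter Topology MeasureTheory ProbabilityTheory Matrix
open scoped ENNReal NNReal

noncomputable section

namespace RidgeAsymptotics

/-- Regression matrix of sample size `N`: its rows are the first `N` regressors. -/
def regMatrix {n : ℕ} (φ : ℕ → Fin n → ℝ) (N : ℕ) : Matrix (Fin N) (Fin n) ℝ :=
  Matrix.of fun t => φ t

/-- Output vector `Y = Φ θ₀ + V` of the linear regression model at sample size `N`. -/
def outputVec {n : ℕ} (φ : ℕ → Fin n → ℝ) (v : ℕ → ℝ) (θ₀ : Fin n → ℝ) (N : ℕ) : Fin N → ℝ :=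
  regMatrix φ N *ᵥ θ₀ + fun t : Fin N => v t

/-- `Q = Φ P Φᵀ + σ² I_N`. -/
def qMatrix {n N : ℕ} (σ : ℝ) (Φ : Matrix (Fin N) (Fin n) ℝ) (P : Matrix (Fin n) (Fin n) ℝ) :
    Matrix (Fin N) (Fin N) ℝ :=
  Φ * P * Φᵀ + σ ^ 2 • (1 : Matrix (Fin N) (Fin N) ℝ)

/-- Regularized least squares estimator `P Φᵀ Q⁻¹ Y`. -/
def rlsEstimator {n N : ℕ} (σ : ℝ) (Φ : Matrix (Fin N) (Fin n) ℝ) (Y : Fin N → ℝ)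
    (P : Matrix (Fin n) (Fin n) ℝ) : Fin n → ℝ :=
  (P * Φᵀ * (qMatrix σ Φ P)⁻¹) *ᵥ Y

/-- Empirical Bayes cost `Yᵀ Q⁻¹ Y + log det Q`. -/
def costEB {n N : ℕ} (σ : ℝ) (Φ : Matrix (Fin N) (Fin n) ℝ) (Y : Fin N → ℝ)
    (P : Matrix (Fin n) (Fin n) ℝ) : ℝ :=
  Y ⬝ᵥ ((qMatrix σ Φ P)⁻¹ *ᵥ Y) + Real.log (qMatrix σ Φ P).det

/-- `SURE_y` cost `‖Y - Φ θ̂‖² + 2 σ² Tr(Φ P Φᵀ Q⁻¹)`, with `θ̂` the regularized least squares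
estimator and `‖·‖` the Euclidean norm. -/
def costSy {n N : ℕ} (σ : ℝ) (Φ : Matrix (Fin N) (Fin n) ℝ) (Y : Fin N → ℝ)
    (P : Matrix (Fin n) (Fin n) ℝ) : ℝ :=
  (Y - Φ *ᵥ rlsEstimator σ Φ Y P) ⬝ᵥ (Y - Φ *ᵥ rlsEstimator σ Φ Y P)
    + 2 * σ ^ 2 * (Φ * P * Φᵀ * (qMatrix σ Φ P)⁻¹).trace

/-- Limit of the (normalized) empirical Bayes cost: `θ₀ᵀ P⁻¹ θ₀ + log det P`. -/
def limitEB {n : ℕ} (θ₀ : Fin n → ℝ) (P : Matrix (Fin n) (Fin n) ℝ) : ℝ :=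
  θ₀ ⬝ᵥ (P⁻¹ *ᵥ θ₀) + Real.log P.det

/-- Limit of the (normalized) `SURE_y` cost: `σ⁴ θ₀ᵀ P⁻ᵀ Σ⁻¹ P⁻¹ θ₀ - 2 σ⁴ Tr(Σ⁻¹ P⁻¹)`. -/
def limitSy {n : ℕ} (σ : ℝ) (Sig : Matrix (Fin n) (Fin n) ℝ) (θ₀ : Fin n → ℝ)
    (P : Matrix (Fin n) (Fin n) ℝ) : ℝ :=
  σ ^ 4 * (θ₀ ⬝ᵥ ((P⁻¹ᵀ * Sig⁻¹ * P⁻¹) *ᵥ θ₀)) - 2 * σ ^ 4 * (Sig⁻¹ * P⁻¹).trace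

/-- Ridge kernel `P(η) = η I_n`. -/
def ridgeKernel (n : ℕ) (η : ℝ) : Matrix (Fin n) (Fin n) ℝ := η • 1

/-- `x` is a minimizer of `f` over `H`. -/
def IsArgmin (f : ℝ → ℝ) (H : Set ℝ) (x : ℝ) : Prop := x ∈ H ∧ IsMinOn f H x

/-- Frobenius norm. -/
def frobNorm {n : ℕ} (A : Matrix (Fin n) (Fin n) ℝ) : ℝ := Real.sqrt (∑ i, ∑ j, A i j ^ 2)

/-- `ξ_N = O_p(a_N)`, for a sequence of positive reals `a_N`, `N ≥ 1`. -/
def IsBigOInProb {Ω : Type*} [MeasurableSpace Ω] (μ : Measure Ω) (ξ : ℕ → Ω → ℝ) (a : ℕ → ℝ) :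
    Prop :=
  ∀ ε : ℝ, 0 < ε → ∃ L : ℝ, 0 < L ∧ ∀ N : ℕ, 1 ≤ N →
    μ {ω | L < |ξ N ω / a N|} < ENNReal.ofReal ε

/-- Asymptotic variance `4 σ² θ₀ᵀ Σ⁻¹ θ₀ / n²`. -/
def asympVarEB {n : ℕ} (σ : ℝ) (Sig : Matrix (Fin n) (Fin n) ℝ) (θ₀ : Fin n → ℝ) : ℝ :=
  4 * σ ^ 2 / (n : ℝ) ^ 2 * (θ₀ ⬝ᵥ (Sig⁻¹ *ᵥ θ₀))

/-- Asymptotic variance `4 σ² θ₀ᵀ Σ⁻³ θ₀ / Tr(Σ⁻¹)²`. -/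
def asympVarSy {n : ℕ} (σ : ℝ) (Sig : Matrix (Fin n) (Fin n) ℝ) (θ₀ : Fin n → ℝ) : ℝ :=
  4 * σ ^ 2 / (Sig⁻¹.trace) ^ 2 * (θ₀ ⬝ᵥ ((Sig⁻¹ ^ 3) *ᵥ θ₀))

/-- Eigenvalues `λ_1 ≥ ⋯ ≥ λ_n` of a real symmetric matrix in decreasing order, with
multiplicity; the index `i : Fin n` stands for `λ_{i+1}`. -/
def sortedEig {n : ℕ} {A : Matrix (Fin n) (Fin n) ℝ} (hA : A.IsHermitian) (i : Fin n) : ℝ :=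
  hA.eigenvalues₀ (Fin.cast (Fintype.card_fin n).symm i)

end RidgeAsymptotics

end

/-! The argument works with exact first-order conditions. The Woodbury and Sylvester identities
reduce both costs to sums over the eigenvalues N mᵢ of ΦᵀΦ. Let z be the least squares estimator θ̂
in the eigenbasis and sᵢ = σ²/(N mᵢ). A minimizer over the open set then solves ∑ wᵢ/(η+sᵢ)ᵏ = ∑ wᵢ
zᵢ²/(η+sᵢ)ᵏ⁺¹, with wᵢ = 1, k = 1 for empirical Bayes and wᵢ = 1/mᵢ, k = 2 for SURE. If the sᵢ were
zero, η would be the weighted mean θ̂ᵀJθ̂ / Tr J, with J = I or J = (ΦᵀΦ/N)⁻¹ respectively. By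
`abs_root_sub_weightedMean_le` every positive root lies within O(1/N) of that mean once the sᵢ are
small, so neither a consistency proof for η nor a Taylor expansion of the costs is needed.

Next, θ̂ = θ₀ + e/√N where, given the regressors, e is Gaussian with covariance σ²(ΦᵀΦ/N)⁻¹. The
quadratic ratio expands into a linear term 2θ₀ᵀJe / Tr J, handled by
`tendstoInDistribution_sum_mul_gaussian`, a quadratic term of order 1/√N, and the cost √N(J - J₀) of
replacing J by its limit. The last one is zero for empirical Bayes and is what the rate hypothesis
makes negligible for SURE. `tendstoInDistribution_of_quadratic_ratio` assembles these, and the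
critical point equation θ₀ᵀJ₀θ₀ = η* Tr J₀ of the limit cost identifies the centre.

For the variance ratio, the 1/λₙ term dominates every spectral sum, so θ₀ᵀΣ⁻¹θ₀ · Tr(Σ⁻¹)² and
θ₀ᵀΣ⁻³θ₀ both behave like (uₙᵀθ₀)² λₙ⁻³. -/

namespace RidgeAsymptotics

/-! ### Convergence in probability as a filter, and a Gaussian limit theorem. -/

section Probability

variable {Ω : Type*} [MeasurableSpace Ω] {μ : Measure Ω}

/-- The filter on `ℕ × Ω` of the families of events whose probability tends to one. -/
def probFilter (μ : Measure Ω) : Filter (ℕ × Ω) where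
  sets := {S | Tendsto (fun N => μ {ω | (N, ω) ∉ S}) atTop (𝓝 0)}
  univ_sets := by simp
  sets_of_superset := by
    intro S T hS hST
    exact tendsto_of_tendsto_of_tendsto_of_le_of_le tendsto_const_nhds hS (fun _ => zero_le)
      (fun N => measure_mono fun ω h h' => h (hST h'))
  inter_sets := by
    intro S T hS hT
    have h := Tendsto.add hS hT
    rw [add_zero] at h
    refine tendsto_of_tendsto_of_tendsto_of_le_of_le tendsto_const_nhds h (fun _ => zero_le)
      (fun N => (measure_mono ?_).trans (measure_union_le _ _))
    intro ω hω
    by_contra hc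
    simp only [Set.mem_union, Set.mem_ofPred_eq, not_or, not_not] at hc
    exact hω hc

lemma eventually_probFilter {p : ℕ × Ω → Prop} :
    (∀ᶠ x in probFilter μ, p x) ↔ Tendsto (fun N => μ {ω | ¬ p (N, ω)}) atTop (𝓝 0) := Iff.rfl

lemma tendsto_fst_probFilter : Tendsto Prod.fst (probFilter μ) atTop := by
  intro S hS
  change Tendsto (fun N => μ {ω | (N, ω) ∉ Prod.fst ⁻¹' S}) atTop (𝓝 0)
  refine tendsto_const_nhds.congr' ?_
  filter_upwards [hS] with N hN
  simp [hN]

/-- Convergence in probability becomes an ordinary `Tendsto`, so products, quotients, squeezing and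
continuous maps apply to it without separate probabilistic versions. -/
lemma tendstoInMeasure_iff_probFilter {X : ℕ → Ω → ℝ} {c : ℝ} :
    TendstoInMeasure μ X atTop (fun _ => c) ↔
      Tendsto (fun x : ℕ × Ω => X x.1 x.2) (probFilter μ) (𝓝 c) := by
  rw [tendstoInMeasure_iff_dist, Metric.tendsto_nhds]
  refine forall₂_congr fun ε _ => ?_
  rw [eventually_probFilter]
  simp only [not_lt]

lemma tendsto_probFilter_of_ae [IsFiniteMeasure μ] {X : ℕ → Ω → ℝ} {c : ℝ}
    (hX : ∀ N, Measurable (X N)) (h : ∀ᵐ ω ∂μ, Tendsto (fun N => X N ω) atTop (𝓝 c)) :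
    Tendsto (fun x : ℕ × Ω => X x.1 x.2) (probFilter μ) (𝓝 c) :=
  tendstoInMeasure_iff_probFilter.1
    (tendstoInMeasure_of_tendsto_ae (fun N => (hX N).aestronglyMeasurable) h)

lemma charFun_map_sum_mul_gaussian {σ : ℝ} {v : ℕ → Ω → ℝ} (hv_meas : ∀ t, Measurable (v t))
    (hv_law : ∀ t, μ.map (v t) = gaussianReal 0 (Real.toNNReal (σ ^ 2)))
    (hv_indep : iIndepFun v μ) {N : ℕ} (c : Fin N → ℝ) (t : ℝ) :
    charFun (μ.map (fun ω => ∑ i, c i * v i ω)) t =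
      Complex.exp (-(σ ^ 2 * (∑ i, c i ^ 2 : ℝ) * t ^ 2 / 2) : ℝ) := by
  have hind : iIndepFun (fun (i : Fin N) ω => c i * v i ω) μ := by
    have h := hv_indep.precomp (g := fun i : Fin N => (i : ℕ)) Fin.val_injective
    exact h.comp (fun i x => c i * x) (fun i => measurable_const_mul _)
  rw [hind.charFun_map_fun_sum_eq_prod (fun i : Fin N => ((hv_meas i).const_mul _).aemeasurable)]
  rw [Finset.prod_apply]
  have : ∀ i : Fin N, charFun (μ.map (fun ω => c i * v i ω)) t =
      Complex.exp (-(σ ^ 2 * (c i ^ 2) * t ^ 2 / 2) : ℝ) := by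
    intro i
    have hm : μ.map (fun ω => c i * v i ω) = (μ.map (v i)).map (fun x => c i * x) := by
      rw [Measure.map_map (measurable_const_mul _) (hv_meas i)]; rfl
    rw [hm, hv_law, gaussianReal_map_const_mul, charFun_gaussianReal]
    congr 1
    have : (0:ℝ) ≤ σ ^ 2 := sq_nonneg _
    simp only [mul_zero, Complex.ofReal_zero, zero_mul, NNReal.coe_mul,
      NNReal.coe_mk, Real.coe_toNNReal _ this]
    push_cast
    ring
  rw [Finset.prod_congr rfl fun i _ => this i, ← Complex.exp_sum]
  congr 1
  push_cast
  rw [Finset.mul_sum, Finset.sum_mul, Finset.sum_div, ← Finset.sum_neg_distrib]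

variable [IsProbabilityMeasure μ]

/-- The portmanteau inequality for the closed set {|x| ≥ ε}, which the point mass at 0 does not
charge. -/
lemma tendsto_probFilter_of_tendstoInDistribution_zero {X : ℕ → Ω → ℝ}
    (h : TendstoInDistribution X atTop (id : ℝ → ℝ) (fun _ => μ) (gaussianReal 0 0)) :
    Tendsto (fun x : ℕ × Ω => X x.1 x.2) (probFilter μ) (𝓝 0) := by
  rw [← tendstoInMeasure_iff_probFilter, tendstoInMeasure_iff_dist]
  intro ε hε
  have hcl : IsClosed {x : ℝ | ε ≤ dist x 0} :=
    isClosed_le continuous_const (continuous_id.dist continuous_const)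
  have h1 := ProbabilityMeasure.limsup_measure_closed_le_of_tendsto h.tendsto hcl
  have h2 : ∀ N, (μ.map (X N)) {x : ℝ | ε ≤ dist x 0} = μ {ω | ε ≤ dist (X N ω) 0} := fun N =>
    Measure.map_apply_of_aemeasurable (h.forall_aemeasurable N) hcl.measurableSet
  simp only [ProbabilityMeasure.coe_mk, Measure.map_id, gaussianReal_zero_var, h2] at h1
  have h3 : (Measure.dirac (0 : ℝ)) {x : ℝ | ε ≤ dist x 0} = 0 := by
    rw [Measure.dirac_apply' _ hcl.measurableSet]
    simp [hε]
  rw [h3] at h1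
  exact tendsto_of_le_liminf_of_limsup_le (zero_le) h1

/-- Central limit theorem for linear combinations of Gaussian noise with random weights that are
independent of the noise. -/
theorem tendstoInDistribution_sum_mul_gaussian {E : Type*} [MeasurableSpace E] {f : Ω → E}
    (hf : Measurable f) {σ : ℝ} {v : ℕ → Ω → ℝ} (hv_meas : ∀ t, Measurable (v t))
    (hv_law : ∀ t, μ.map (v t) = gaussianReal 0 (Real.toNNReal (σ ^ 2)))
    (hv_indep : iIndepFun v μ) (hfv : IndepFun f (fun ω t => v t ω) μ)
    (c : (N : ℕ) → E → Fin N → ℝ) (hc : ∀ N, Measurable (c N)) {τ : ℝ}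
    (hlim : ∀ᵐ ω ∂μ, Tendsto (fun N => ∑ i, c N (f ω) i ^ 2) atTop (𝓝 τ)) :
    TendstoInDistribution (fun N ω => ∑ i, c N (f ω) i * v i ω) atTop (id : ℝ → ℝ)
      (fun _ => μ) (gaussianReal 0 (Real.toNNReal (σ ^ 2 * τ))) := by
  have hvm : Measurable (fun ω t => v t ω) := measurable_pi_lambda _ hv_meas
  have hci : ∀ N i, Measurable fun x => c N x i := fun N i => (measurable_pi_apply i).comp (hc N)
  have hXm : ∀ N, Measurable fun ω => ∑ i, c N (f ω) i * v i ω := fun N =>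
    Finset.measurable_sum _ fun i _ => ((hci N i).comp hf).mul (hv_meas i)
  have hτ : 0 ≤ τ := by
    obtain ⟨ω, hω⟩ := hlim.exists
    exact ge_of_tendsto' hω fun N => Finset.sum_nonneg fun i _ => sq_nonneg _
  refine ⟨fun N => (hXm N).aemeasurable, aemeasurable_id, ?_⟩
  refine ProbabilityMeasure.tendsto_of_tendsto_charFun fun t => ?_
  simp only [ProbabilityMeasure.coe_mk, Measure.map_id]
  -- Conditioning on the regressors: by independence the joint law is a product, and Fubini averages
  -- the Gaussian characteristic function with frozen weights.
  have key : ∀ N, charFun (μ.map (fun ω => ∑ i, c N (f ω) i * v i ω)) t =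
      ∫ ω, Complex.exp (-(σ ^ 2 * (∑ i, c N (f ω) i ^ 2 : ℝ) * t ^ 2 / 2) : ℝ) ∂μ := by
    intro N
    have hS : Measurable fun p : E × (ℕ → ℝ) => ∑ i : Fin N, c N p.1 i * p.2 i :=
      Finset.measurable_sum _ fun i _ =>
        ((hci N i).comp measurable_fst).mul ((measurable_pi_apply _).comp measurable_snd)
    have hG : Measurable fun p : E × (ℕ → ℝ) =>
        Complex.exp (t * (∑ i : Fin N, c N p.1 i * p.2 i : ℝ) * Complex.I) :=
      Complex.measurable_exp.comp
        (((Complex.measurable_ofReal.comp hS).const_mul _).mul_const _)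
    have hGn : ∀ p : E × (ℕ → ℝ),
        ‖Complex.exp (t * (∑ i : Fin N, c N p.1 i * p.2 i : ℝ) * Complex.I)‖ ≤ 1 := by
      intro p
      rw [← Complex.ofReal_mul, Complex.norm_exp_ofReal_mul_I]
    rw [charFun_apply_real, integral_map (hXm N).aemeasurable (by fun_prop)]
    have e1 := integral_map (μ := μ) (φ := fun ω => (f ω, fun t => v t ω))
      (hf.prodMk hvm).aemeasurable hG.aestronglyMeasurable
    rw [← e1, (indepFun_iff_map_prod_eq_prod_map_map hf.aemeasurable hvm.aemeasurable).1 hfv]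
    have : IsProbabilityMeasure (μ.map f) := Measure.isProbabilityMeasure_map hf.aemeasurable
    have : IsProbabilityMeasure (μ.map fun ω t => v t ω) :=
      Measure.isProbabilityMeasure_map hvm.aemeasurable
    rw [integral_prod _ (Integrable.of_bound hG.aestronglyMeasurable 1 (ae_of_all _ hGn))]
    have inner : ∀ x : E, ∫ w, Complex.exp (t * (∑ i : Fin N, c N x i * w i : ℝ) * Complex.I)
        ∂(μ.map fun ω t => v t ω) =
        Complex.exp (-(σ ^ 2 * (∑ i, c N x i ^ 2 : ℝ) * t ^ 2 / 2) : ℝ) := by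
      intro x
      rw [← charFun_map_sum_mul_gaussian hv_meas hv_law hv_indep (c N x) t, charFun_apply_real,
        integral_map (φ := fun ω => ∑ i : Fin N, c N x i * v i ω)
          (Finset.measurable_sum _ fun (i : Fin N) _ => (hv_meas i).const_mul _).aemeasurable
          (by fun_prop)]
      refine integral_map (φ := fun ω t => v t ω) hvm.aemeasurable ?_
      exact (hG.comp (measurable_prodMk_left (x := x))).aestronglyMeasurable
    simp only [inner]
    refine integral_map hf.aemeasurable ?_
    have : Measurable fun x : E => ∑ i, c N x i ^ 2 :=
      Finset.measurable_sum _ fun i _ => (hci N i).pow_const 2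
    exact (Measurable.aestronglyMeasurable (by fun_prop))
  simp only [key]
  have hlimit : charFun (gaussianReal 0 (Real.toNNReal (σ ^ 2 * τ))) t =
      ∫ _ω, Complex.exp (-(σ ^ 2 * τ * t ^ 2 / 2) : ℝ) ∂μ := by
    rw [charFun_gaussianReal, integral_const, probReal_univ, one_smul]
    have : 0 ≤ σ ^ 2 * τ := by positivity
    rw [Real.coe_toNNReal _ this]
    push_cast
    congr 1
    ring
  rw [hlimit]
  -- The exponent is nonpositive, so the constant 1 dominates.
  refine tendsto_integral_of_dominated_convergence (fun _ => 1) (fun N => ?_)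
    (integrable_const _) (fun N => ae_of_all _ fun ω => ?_) ?_
  · have : Measurable fun ω => ∑ i, c N (f ω) i ^ 2 :=
      Finset.measurable_sum _ fun i _ => ((hci N i).comp hf).pow_const 2
    exact (Measurable.aestronglyMeasurable (by fun_prop))
  · rw [← Complex.ofReal_exp, Complex.norm_real, Real.norm_of_nonneg (Real.exp_pos _).le,
      Real.exp_le_one_iff, neg_nonpos]
    have : 0 ≤ ∑ i, c N (f ω) i ^ 2 := Finset.sum_nonneg fun i _ => sq_nonneg _
    positivity
  · filter_upwards [hlim] with ω hω
    have : Continuous fun x : ℝ => Complex.exp (-(σ ^ 2 * x * t ^ 2 / 2) : ℝ) := by fun_prop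
    exact (this.tendsto τ).comp hω

end Probability

/-! ### Calculus of matrices diagonal in a fixed orthogonal basis. -/

section Spectral

variable {n : ℕ}

/-- The matrix `U diag(d) Uᵀ`. -/
def specMatrix (U : Matrix (Fin n) (Fin n) ℝ) (d : Fin n → ℝ) : Matrix (Fin n) (Fin n) ℝ :=
  U * diagonal d * Uᵀ

lemma exists_eq_specMatrix {M : Matrix (Fin n) (Fin n) ℝ} (hM : M.PosDef) :
    ∃ (U : Matrix (Fin n) (Fin n) ℝ) (m : Fin n → ℝ),
      U * Uᵀ = 1 ∧ Uᵀ * U = 1 ∧ (∀ i, 0 < m i) ∧ M = specMatrix U m := by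
  refine ⟨hM.isHermitian.eigenvectorUnitary, hM.isHermitian.eigenvalues, ?_, ?_,
    hM.eigenvalues_pos, ?_⟩
  · have := Unitary.coe_mul_star_self hM.isHermitian.eigenvectorUnitary
    rwa [Unitary.coe_star, star_eq_conjTranspose, conjTranspose_eq_transpose_of_trivial] at this
  · have := Unitary.coe_star_mul_self hM.isHermitian.eigenvectorUnitary
    rwa [star_eq_conjTranspose, conjTranspose_eq_transpose_of_trivial] at this
  · have h := hM.isHermitian.spectral_theorem
    rw [Unitary.conjStarAlgAut_apply, star_eq_conjTranspose,
      conjTranspose_eq_transpose_of_trivial] at h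
    exact h

variable {U : Matrix (Fin n) (Fin n) ℝ}

lemma specMatrix_one (hU : U * Uᵀ = 1) : specMatrix U 1 = 1 := by
  simp [specMatrix, hU]

lemma specMatrix_mul (hU : Uᵀ * U = 1) (a b : Fin n → ℝ) :
    specMatrix U a * specMatrix U b = specMatrix U (a * b) := by
  calc _ = U * diagonal a * (Uᵀ * U) * diagonal b * Uᵀ := by
        simp only [specMatrix, Matrix.mul_assoc]
    _ = _ := by
        rw [hU, Matrix.mul_one, Matrix.mul_assoc U, diagonal_mul_diagonal]; rfl

lemma specMatrix_smul (c : ℝ) (a : Fin n → ℝ) : c • specMatrix U a = specMatrix U (c • a) := by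
  simp [specMatrix, diagonal_smul]

lemma specMatrix_add (a b : Fin n → ℝ) :
    specMatrix U a + specMatrix U b = specMatrix U (a + b) := by
  have : diagonal (a + b) = diagonal a + diagonal b := (diagonal_add a b).symm
  rw [specMatrix, specMatrix, specMatrix, this, Matrix.mul_add, Matrix.add_mul]

lemma specMatrix_inv (hU : U * Uᵀ = 1) (hU' : Uᵀ * U = 1) {a : Fin n → ℝ} (ha : ∀ i, a i ≠ 0) :
    (specMatrix U a)⁻¹ = specMatrix U a⁻¹ := by
  refine Matrix.inv_eq_right_inv ?_
  rw [specMatrix_mul hU', ← specMatrix_one hU]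
  congr 1
  ext i
  simp [ha i]

lemma trace_specMatrix (hU : Uᵀ * U = 1) (a : Fin n → ℝ) : (specMatrix U a).trace = ∑ i, a i := by
  rw [specMatrix, Matrix.trace_mul_comm, ← Matrix.mul_assoc, hU, Matrix.one_mul,
    Matrix.trace_diagonal]

lemma det_specMatrix (hU : U * Uᵀ = 1) (a : Fin n → ℝ) : (specMatrix U a).det = ∏ i, a i := by
  rw [specMatrix, det_mul, det_mul, det_diagonal, mul_right_comm, ← det_mul, hU, det_one, one_mul]

lemma dotProduct_specMatrix_mulVec (a x : Fin n → ℝ) :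
    x ⬝ᵥ (specMatrix U a *ᵥ x) = ∑ i, a i * (Uᵀ *ᵥ x) i ^ 2 := by
  have h : specMatrix U a *ᵥ x = U *ᵥ (diagonal a *ᵥ (Uᵀ *ᵥ x)) := by
    simp [specMatrix, Matrix.mulVec_mulVec, Matrix.mul_assoc]
  rw [h, dotProduct_mulVec, ← mulVec_transpose]
  simp only [dotProduct, mulVec_diagonal]
  exact Finset.sum_congr rfl fun i _ => by ring

lemma transpose_mulVec_specMatrix_mulVec (hU : Uᵀ * U = 1) (a x : Fin n → ℝ) (i : Fin n) :
    (Uᵀ *ᵥ (specMatrix U a *ᵥ x)) i = a i * (Uᵀ *ᵥ x) i := by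
  have h : Uᵀ *ᵥ (specMatrix U a *ᵥ x) = diagonal a *ᵥ (Uᵀ *ᵥ x) := by
    simp only [specMatrix, Matrix.mulVec_mulVec]
    rw [← Matrix.mul_assoc, ← Matrix.mul_assoc, hU, Matrix.one_mul]
  rw [h, mulVec_diagonal]

end Spectral

/-! ### Spectral form of the two costs and their first-order conditions. -/

section Costs

variable {n N : ℕ} {σ η : ℝ} {Φ : Matrix (Fin N) (Fin n) ℝ} {Y : Fin N → ℝ}
  {U : Matrix (Fin n) (Fin n) ℝ} {g : Fin n → ℝ}

/-- The diagonal entries `1 / (g + σ² / η)` of the ridge resolvent. -/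
noncomputable def ridgeResolvent (σ : ℝ) (g : Fin n → ℝ) (η : ℝ) (i : Fin n) : ℝ :=
  η / (η * g i + σ ^ 2)

lemma ridge_denom_pos (hσ : 0 < σ) (hη : 0 < η) (hg : ∀ i, 0 < g i) (i : Fin n) :
    0 < η * g i + σ ^ 2 := by
  have := hg i
  positivity

/-- With K = (ΦᵀΦ + (σ²/η) I)⁻¹ this is η(I - ΦᵀΦK) = σ²K, the single identity behind both the
Woodbury formula for Q⁻¹ and the simplified gain PΦᵀQ⁻¹ = KΦᵀ. -/
lemma one_sub_gram_mul_resolvent (hσ : 0 < σ) (hη : 0 < η) (hg : ∀ i, 0 < g i)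
    (hU : U * Uᵀ = 1) (hU' : Uᵀ * U = 1) (hG : Φᵀ * Φ = specMatrix U g) :
    η • ((1 : Matrix (Fin n) (Fin n) ℝ) - Φᵀ * Φ * specMatrix U (ridgeResolvent σ g η)) =
      σ ^ 2 • specMatrix U (ridgeResolvent σ g η) := by
  rw [smul_sub, sub_eq_iff_eq_add, hG, specMatrix_mul hU', ← specMatrix_one hU, specMatrix_smul,
    specMatrix_smul, specMatrix_smul, specMatrix_add]
  congr 1
  ext i
  have := (ridge_denom_pos hσ hη hg i).ne'
  simp only [Pi.smul_apply, Pi.one_apply, Pi.add_apply, Pi.mul_apply, ridgeResolvent, smul_eq_mul]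
  field_simp
  ring

lemma qMatrix_inv (hσ : 0 < σ) (hη : 0 < η) (hg : ∀ i, 0 < g i)
    (hU : U * Uᵀ = 1) (hU' : Uᵀ * U = 1) (hG : Φᵀ * Φ = specMatrix U g) :
    (qMatrix σ Φ (ridgeKernel n η))⁻¹ =
      (σ ^ 2)⁻¹ • (1 - Φ * specMatrix U (ridgeResolvent σ g η) * Φᵀ) := by
  refine Matrix.inv_eq_right_inv ?_
  have h := one_sub_gram_mul_resolvent hσ hη hg hU hU' hG
  set K := specMatrix U (ridgeResolvent σ g η)
  have hσ2 : σ ^ 2 ≠ 0 := by positivity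
  rw [Matrix.mul_smul, inv_smul_eq_iff₀ hσ2, qMatrix, ridgeKernel]
  have e : (Φ * η • (1 : Matrix (Fin n) (Fin n) ℝ) * Φᵀ + σ ^ 2 • 1) * (1 - Φ * K * Φᵀ) =
      Φ * (η • ((1 : Matrix (Fin n) (Fin n) ℝ) - Φᵀ * Φ * K)) * Φᵀ - σ ^ 2 • (Φ * K * Φᵀ)
        + σ ^ 2 • 1 := by
    simp only [Matrix.mul_smul, Matrix.smul_mul, Matrix.mul_one, Matrix.mul_sub, Matrix.add_mul,
      Matrix.sub_mul, Matrix.one_mul, smul_sub, Matrix.mul_assoc]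
    abel
  rw [e, h]
  simp [Matrix.mul_smul, Matrix.smul_mul]

lemma rls_gain (hσ : 0 < σ) (hη : 0 < η) (hg : ∀ i, 0 < g i)
    (hU : U * Uᵀ = 1) (hU' : Uᵀ * U = 1) (hG : Φᵀ * Φ = specMatrix U g) :
    ridgeKernel n η * Φᵀ * (qMatrix σ Φ (ridgeKernel n η))⁻¹ =
      specMatrix U (ridgeResolvent σ g η) * Φᵀ := by
  rw [qMatrix_inv hσ hη hg hU hU' hG]
  have h := one_sub_gram_mul_resolvent hσ hη hg hU hU' hG
  set K := specMatrix U (ridgeResolvent σ g η)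
  have hσ2 : σ ^ 2 ≠ 0 := by positivity
  rw [Matrix.mul_smul, inv_smul_eq_iff₀ hσ2, ridgeKernel, ← Matrix.smul_mul, ← h]
  simp only [Matrix.smul_mul, Matrix.mul_one, Matrix.mul_sub, Matrix.sub_mul, Matrix.one_mul,
    Matrix.mul_assoc, smul_sub]

/-- The Woodbury formula handles the quadratic form and det(1 + AB) = det(1 + BA) the determinant.
What remains depends on η through n scalar functions only and can be differentiated termwise. -/
lemma costEB_ridge (hσ : 0 < σ) (hη : 0 < η) (hg : ∀ i, 0 < g i)
    (hU : U * Uᵀ = 1) (hU' : Uᵀ * U = 1) (hG : Φᵀ * Φ = specMatrix U g) :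
    costEB σ Φ Y (ridgeKernel n η) =
      (σ ^ 2)⁻¹ * (Y ⬝ᵥ Y - ∑ i, ridgeResolvent σ g η i * (Uᵀ *ᵥ (Φᵀ *ᵥ Y)) i ^ 2) +
        (Real.log ((σ ^ 2) ^ N) + ∑ i, Real.log (1 + (σ ^ 2)⁻¹ * (η * g i))) := by
  have hσ2 : 0 < σ ^ 2 := by positivity
  unfold costEB
  congr 1
  · rw [qMatrix_inv hσ hη hg hU hU' hG, smul_mulVec, dotProduct_smul, smul_eq_mul,
      ← dotProduct_specMatrix_mulVec, sub_mulVec, one_mulVec, dotProduct_sub]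
    congr 2
    rw [← mulVec_mulVec, ← mulVec_mulVec, dotProduct_mulVec, ← mulVec_transpose]
  · have hq : qMatrix σ Φ (ridgeKernel n η) = σ ^ 2 • (1 + Φ * (((σ ^ 2)⁻¹ * η) • Φᵀ)) := by
      simp [qMatrix, ridgeKernel, smul_smul, mul_inv_cancel_left₀ hσ2.ne', add_comm]
    have hs : 1 + (((σ ^ 2)⁻¹ * η) • Φᵀ) * Φ =
        specMatrix U (fun i => 1 + (σ ^ 2)⁻¹ * (η * g i)) := by
      rw [Matrix.smul_mul, hG, ← specMatrix_one hU, specMatrix_smul, specMatrix_add]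
      congr 1
      ext i
      simp [mul_assoc]
    have hp : ∀ i, 0 < 1 + (σ ^ 2)⁻¹ * (η * g i) := fun i => by
      have := hg i
      positivity
    rw [hq, det_smul, det_one_add_mul_comm, hs, det_specMatrix hU, Fintype.card_fin,
      Real.log_mul (by positivity) (Finset.prod_ne_zero_iff.2 fun i _ => (hp i).ne'),
      Real.log_prod fun i _ => (hp i).ne']

lemma costSy_ridge (hσ : 0 < σ) (hη : 0 < η) (hg : ∀ i, 0 < g i)
    (hU : U * Uᵀ = 1) (hU' : Uᵀ * U = 1) (hG : Φᵀ * Φ = specMatrix U g) :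
    costSy σ Φ Y (ridgeKernel n η) =
      Y ⬝ᵥ Y + ∑ i, ((g i * ridgeResolvent σ g η i ^ 2 - 2 * ridgeResolvent σ g η i) *
        (Uᵀ *ᵥ (Φᵀ *ᵥ Y)) i ^ 2 + 2 * σ ^ 2 * (g i * ridgeResolvent σ g η i)) := by
  unfold costSy rlsEstimator
  have hgain := rls_gain hσ hη hg hU hU' hG
  rw [Matrix.mul_assoc Φ, Matrix.mul_assoc Φ, hgain]
  set K := specMatrix U (ridgeResolvent σ g η) with hK
  set b := Φᵀ *ᵥ Y with hb
  have e1 : (K * Φᵀ) *ᵥ Y = K *ᵥ b := by rw [hb, mulVec_mulVec]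
  have e2 : Y ⬝ᵥ (Φ *ᵥ (K *ᵥ b)) = b ⬝ᵥ (K *ᵥ b) := by
    rw [dotProduct_mulVec, ← mulVec_transpose]
  have e3 : (Φ *ᵥ (K *ᵥ b)) ⬝ᵥ (Φ *ᵥ (K *ᵥ b)) = (K *ᵥ b) ⬝ᵥ (specMatrix U g *ᵥ (K *ᵥ b)) := by
    rw [← hG, ← mulVec_mulVec, dotProduct_mulVec (K *ᵥ b) Φᵀ, vecMul_transpose]
  have e4 : (Φ * (K * Φᵀ)).trace = ∑ i, g i * ridgeResolvent σ g η i := by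
    rw [Matrix.trace_mul_comm, Matrix.mul_assoc, hG, hK, specMatrix_mul hU', trace_specMatrix hU']
    exact Finset.sum_congr rfl fun i _ => mul_comm _ _
  rw [e1, e4, sub_dotProduct, dotProduct_sub, dotProduct_sub, e3, e2,
    dotProduct_comm (Φ *ᵥ (K *ᵥ b)) Y, e2, hK, dotProduct_specMatrix_mulVec,
    dotProduct_specMatrix_mulVec, Finset.sum_add_distrib, Finset.mul_sum]
  simp only [transpose_mulVec_specMatrix_mulVec hU', sub_mul, Finset.sum_sub_distrib, mul_pow]
  have : ∑ i, 2 * ridgeResolvent σ g η i * (Uᵀ *ᵥ b) i ^ 2 =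
      2 * ∑ i, ridgeResolvent σ g η i * (Uᵀ *ᵥ b) i ^ 2 := by
    rw [Finset.mul_sum]
    exact Finset.sum_congr rfl fun i _ => by ring
  rw [this]
  simp only [mul_assoc]
  ring

lemma hasDerivAt_ridgeResolvent (hσ : 0 < σ) (hη : 0 < η) (hg : ∀ i, 0 < g i) (i : Fin n) :
    HasDerivAt (fun x => ridgeResolvent σ g x i) (σ ^ 2 / (η * g i + σ ^ 2) ^ 2) η := by
  have h := (hasDerivAt_id η).div (((hasDerivAt_id η).mul_const (g i)).add_const (σ ^ 2))
    (ridge_denom_pos hσ hη hg i).ne'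
  refine h.congr_deriv ?_
  simp only [id]
  ring

/-- A minimizer over an open set of positive reals is a critical point. -/
lemma IsArgmin.deriv_eq_zero {F f : ℝ → ℝ} {H : Set ℝ} (hH : IsOpen H) (hpos : ∀ x ∈ H, 0 < x)
    {x d : ℝ} (hx : IsArgmin F H x) (hF : ∀ y, 0 < y → F y = f y) (hd : HasDerivAt f d x) :
    d = 0 := by
  have hmin : IsLocalMin F x := hx.2.isLocalMin (hH.mem_nhds hx.1)
  -- The closed form `f` is available only at positive arguments, which still fill a neighbourhood
  -- of `x`.
  have heq : f =ᶠ[𝓝 x] F := by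
    filter_upwards [lt_mem_nhds (hpos x hx.1)] with y hy using (hF y hy).symm
  exact (hmin.congr heq.symm).hasDerivAt_eq_zero hd

lemma costEB_critical (hσ : 0 < σ) (hg : ∀ i, 0 < g i)
    (hU : U * Uᵀ = 1) (hU' : Uᵀ * U = 1) (hG : Φᵀ * Φ = specMatrix U g)
    {H : Set ℝ} (hH : IsOpen H) (hpos : ∀ x ∈ H, 0 < x)
    (hmin : IsArgmin (fun x => costEB σ Φ Y (ridgeKernel n x)) H η) :
    ∑ i, g i / (η * g i + σ ^ 2) = ∑ i, (Uᵀ *ᵥ (Φᵀ *ᵥ Y)) i ^ 2 / (η * g i + σ ^ 2) ^ 2 := by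
  have hη := hpos η hmin.1
  have hσ2 : σ ^ 2 ≠ 0 := by positivity
  have hlog : ∀ i, HasDerivAt (fun x => Real.log (1 + (σ ^ 2)⁻¹ * (x * g i)))
      (g i / (η * g i + σ ^ 2)) η := by
    intro i
    have hgi := hg i
    have h := ((((hasDerivAt_id η).mul_const (g i)).const_mul (σ ^ 2)⁻¹).const_add 1).log
      (by simp only [id]; positivity)
    refine h.congr_deriv ?_
    simp only [id]
    have := ridge_denom_pos hσ hη hg i
    field_simp
    ring
  have hd := (((HasDerivAt.fun_sum (u := Finset.univ) fun i _ =>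
    (hasDerivAt_ridgeResolvent hσ hη hg i).mul_const ((Uᵀ *ᵥ (Φᵀ *ᵥ Y)) i ^ 2)).const_sub
      (Y ⬝ᵥ Y)).const_mul (σ ^ 2)⁻¹).add
    ((HasDerivAt.fun_sum (u := Finset.univ) fun i _ => hlog i).const_add
      (Real.log ((σ ^ 2) ^ N)))
  have h0 := hmin.deriv_eq_zero hH hpos
    (fun y hy => costEB_ridge (Y := Y) hσ hy hg hU hU' hG) hd
  rw [mul_neg, neg_add_eq_zero, Finset.mul_sum] at h0
  rw [← h0]
  refine Finset.sum_congr rfl fun i _ => ?_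
  have := ridge_denom_pos hσ hη hg i
  field_simp

lemma costSy_critical (hσ : 0 < σ) (hg : ∀ i, 0 < g i)
    (hU : U * Uᵀ = 1) (hU' : Uᵀ * U = 1) (hG : Φᵀ * Φ = specMatrix U g)
    {H : Set ℝ} (hH : IsOpen H) (hpos : ∀ x ∈ H, 0 < x)
    (hmin : IsArgmin (fun x => costSy σ Φ Y (ridgeKernel n x)) H η) :
    ∑ i, g i / (η * g i + σ ^ 2) ^ 2 =
      ∑ i, (Uᵀ *ᵥ (Φᵀ *ᵥ Y)) i ^ 2 / (η * g i + σ ^ 2) ^ 3 := by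
  have hη := hpos η hmin.1
  have hd := (HasDerivAt.fun_sum (u := Finset.univ) fun i _ =>
    (((((hasDerivAt_ridgeResolvent hσ hη hg i).pow 2).const_mul (g i)).sub
      ((hasDerivAt_ridgeResolvent hσ hη hg i).const_mul 2)).mul_const
        ((Uᵀ *ᵥ (Φᵀ *ᵥ Y)) i ^ 2)).add
    (((hasDerivAt_ridgeResolvent hσ hη hg i).const_mul (g i)).const_mul (2 * σ ^ 2))).const_add
      (Y ⬝ᵥ Y)
  have h0 := hmin.deriv_eq_zero hH hpos
    (fun y hy => costSy_ridge (Y := Y) hσ hy hg hU hU' hG) hd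
  -- With d = ηg + σ² and K = η/d, one has K' = σ²/d² and gK - 1 = -σ²/d, so 2σ⁴ factors out of both
  -- parts of the derivative.
  have h1 : ∑ i, (2 * σ ^ 4) * (g i / (η * g i + σ ^ 2) ^ 2 -
      (Uᵀ *ᵥ (Φᵀ *ᵥ Y)) i ^ 2 / (η * g i + σ ^ 2) ^ 3) = 0 := by
    rw [← h0]
    refine Finset.sum_congr rfl fun i _ => ?_
    have := ridge_denom_pos hσ hη hg i
    simp only [ridgeResolvent, Nat.add_one_sub_one, pow_one, Nat.cast_ofNat]
    field_simp
    ring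
  rw [← Finset.mul_sum, Finset.sum_sub_distrib] at h1
  exact sub_eq_zero.1 ((mul_eq_zero.1 h1).resolve_left (by positivity))

end Costs

/-! ### Deterministic location of the roots of the first-order condition. -/

section CriticalPoint

/-- Convexity: on [0, 1] the graph of (1 + x)ᵏ lies below its chord. -/
lemma one_add_pow_le {x : ℝ} (hx : 0 ≤ x) (hx1 : x ≤ 1) (k : ℕ) :
    (1 + x) ^ k ≤ 1 + (2 ^ k - 1) * x := by
  induction k with
  | zero => simp
  | succ k ih =>
    have h2 : (1 : ℝ) ≤ 2 ^ k := one_le_pow₀ one_le_two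
    have h3 : 0 ≤ (2 ^ k - 1) * (x * (1 - x)) :=
      mul_nonneg (by linarith) (mul_nonneg hx (by linarith))
    calc (1 + x) ^ (k + 1) ≤ (1 + (2 ^ k - 1) * x) * (1 + x) := by
          rw [pow_succ]; gcongr
      _ ≤ _ := by rw [pow_succ]; nlinarith

/-- A root of the first order condition `∑ w / (η + s)ᵏ = ∑ w y / (η + s)ᵏ⁺¹` is close to the
weighted mean of `y` when the perturbations `s` are small and comparable to each other. -/
theorem abs_root_sub_weightedMean_le {ι : Type*} [Fintype ι] (k : ℕ) {w y s : ι → ℝ}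
    (hw : ∀ i, 0 < w i) (hy : ∀ i, 0 ≤ y i) (hs : ∀ i, 0 < s i) {S ρ η : ℝ} (hη : 0 < η)
    (hsS : ∀ i, s i ≤ S) (hSs : ∀ i, S ≤ ρ * s i)
    (heq : ∑ i, w i / (η + s i) ^ k = ∑ i, w i * y i / (η + s i) ^ (k + 1))
    (hT : 0 < ∑ i, w i * y i) (hsmall : 2 * ρ ^ (k + 1) * S * ∑ i, w i ≤ ∑ i, w i * y i) :
    |η - (∑ i, w i * y i) / ∑ i, w i| ≤ (2 ^ (k + 2) + 1) * ρ ^ (k + 1) * S := by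
  obtain ⟨i₀⟩ : Nonempty ι := by
    by_contra h
    rw [not_nonempty_iff] at h
    simp at hT
  have hS : 0 < S := (hs i₀).trans_le (hsS i₀)
  have hρ : 1 ≤ ρ := by
    have := (hsS i₀).trans (hSs i₀)
    nlinarith [hs i₀]
  set W := ∑ i, w i with hWdef
  set T := ∑ i, w i * y i with hTdef
  set R := ρ ^ (k + 1) with hR
  have hR1 : 1 ≤ R := one_le_pow₀ hρ
  have hW : 0 < W := Finset.sum_pos (fun i _ => hw i) ⟨i₀, Finset.mem_univ _⟩
  -- Multiplying the equation by (η+S)ᵏ⁺¹ turns it into a balance with weights w r, where 1 ≤ r ≤ R,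
  -- and r is close to 1 when S/η is small.
  set r : ι → ℝ := fun i => ((η + S) / (η + s i)) ^ (k + 1) with hr
  have hpos : ∀ i, 0 < η + s i := fun i => add_pos hη (hs i)
  have hr1 : ∀ i, 1 ≤ r i := fun i =>
    one_le_pow₀ ((one_le_div (hpos i)).2 (by linarith [hsS i]))
  have hrR : ∀ i, r i ≤ R := fun i => by
    refine pow_le_pow_left₀ (div_nonneg (by linarith) (hpos i).le) ?_ _
    rw [div_le_iff₀ (hpos i)]
    nlinarith [hSs i]
  have hbal : ∑ i, w i * r i * (η + s i) = ∑ i, w i * r i * y i := by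
    have h := congrArg (fun z => (η + S) ^ (k + 1) * z) heq
    simp only [Finset.mul_sum] at h
    convert h using 2 with i _ i _
    · have := hpos i
      simp only [hr, div_pow]
      field_simp
      ring
    · simp only [hr, div_pow]
      ring
  have hlow : T ≤ R * (η + S) * W := by
    calc T ≤ ∑ i, w i * r i * y i := Finset.sum_le_sum fun i _ => by
          have := mul_nonneg (hw i).le (hy i)
          nlinarith [hr1 i]
      _ = ∑ i, w i * r i * (η + s i) := hbal.symm
      _ ≤ ∑ i, R * (η + S) * w i := Finset.sum_le_sum fun i _ => by
          have h1 : r i * (η + s i) ≤ R * (η + S) :=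
            mul_le_mul (hrR i) (by linarith [hsS i]) (hpos i).le (by linarith)
          nlinarith [hw i]
      _ = _ := by rw [← Finset.mul_sum]
  -- Since RSW ≤ T/2, the crude bound T ≤ R(η+S)W already keeps η away from 0. Comparing with 2RSW ≤
  -- T then gives S ≤ η.
  have hηT : T ≤ 2 * R * η * W := by nlinarith
  have hSη : S ≤ η := by
    have : (R * W) * (2 * S) ≤ (R * W) * (2 * η) := by nlinarith
    have := le_of_mul_le_mul_left this (by positivity)
    linarith
  -- The chord bound applied to (1 + S/η)ᵏ⁺¹ gives r - 1 ≤ (2ᵏ⁺¹ - 1) S/η.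
  set ε := 2 ^ (k + 1) * (S / η) with hε
  have hε0 : 0 ≤ ε := by positivity
  have hrε : ∀ i, r i - 1 ≤ ε := fun i => by
    have h1 : r i ≤ (1 + S / η) ^ (k + 1) := by
      refine pow_le_pow_left₀ (div_nonneg (by linarith) (hpos i).le) ?_ _
      rw [show 1 + S / η = (η + S) / η by field_simp]
      exact div_le_div_of_nonneg_left (by linarith) hη (by linarith [hs i])
    have h2 := one_add_pow_le (x := S / η) (by positivity) ((div_le_one hη).2 hSη) (k + 1)
    have h3 : 0 < S / η := by positivity
    rw [hε]
    linarith
  -- The factor η cancels against the 1/η in ε, so no upper bound on η is ever required.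
  have hεT : ε * T ≤ 2 ^ (k + 2) * R * S * W := by
    calc ε * T ≤ ε * (2 * R * η * W) := by gcongr
      _ = _ := by rw [hε]; field_simp; ring
  have hεη : ε * (η * W) = 2 ^ (k + 1) * S * W := by rw [hε]; field_simp
  -- Subtracting the balance gives ηW - T = ∑ (w(r-1)y - w(r-1)η - wrs). Only the first term is
  -- nonnegative. The reverse estimate keeps the other two.
  have hup : η * W - T ≤ ε * T := by
    have e : η * W - T = ∑ i, (w i * (r i - 1) * y i - w i * (r i - 1) * η - w i * r i * s i) := by
      have : ∑ i, (w i * (r i - 1) * y i - w i * (r i - 1) * η - w i * r i * s i) =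
          (∑ i, w i * r i * y i - ∑ i, w i * r i * (η + s i)) + (η * W - T) := by
        rw [hWdef, hTdef, Finset.mul_sum, ← Finset.sum_sub_distrib, ← Finset.sum_sub_distrib,
          ← Finset.sum_add_distrib]
        exact Finset.sum_congr rfl fun i _ => by ring
      rw [this, hbal, sub_self, zero_add]
    rw [e, hTdef, Finset.mul_sum]
    refine Finset.sum_le_sum fun i _ => ?_
    have h1 : 0 ≤ w i * (r i - 1) * η :=
      mul_nonneg (mul_nonneg (hw i).le (by linarith [hr1 i])) hη.le
    have h2 : 0 ≤ w i * r i * s i :=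
      mul_nonneg (mul_nonneg (hw i).le (by linarith [hr1 i])) (hs i).le
    have h3 := mul_le_mul_of_nonneg_right (hrε i) (mul_nonneg (hw i).le (hy i))
    nlinarith
  have hdown : T - η * W ≤ ε * (η * W) + R * S * W := by
    have e : T - η * W = ∑ i, (w i * (r i - 1) * η + w i * r i * s i - w i * (r i - 1) * y i) := by
      have : ∑ i, (w i * (r i - 1) * η + w i * r i * s i - w i * (r i - 1) * y i) =
          (∑ i, w i * r i * (η + s i) - ∑ i, w i * r i * y i) + (T - η * W) := by
        rw [hWdef, hTdef, Finset.mul_sum, ← Finset.sum_sub_distrib, ← Finset.sum_sub_distrib,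
          ← Finset.sum_add_distrib]
        exact Finset.sum_congr rfl fun i _ => by ring
      rw [this, hbal, sub_self, zero_add]
    have e2 : ε * (η * W) + R * S * W = ∑ i, (ε * (η * w i) + R * S * w i) := by
      rw [hWdef, Finset.sum_add_distrib, Finset.mul_sum, Finset.mul_sum, Finset.mul_sum]
    rw [e, e2]
    refine Finset.sum_le_sum fun i _ => ?_
    have h1 : 0 ≤ w i * (r i - 1) * y i :=
      mul_nonneg (mul_nonneg (hw i).le (by linarith [hr1 i])) (hy i)
    have h2 : r i * s i ≤ R * S := mul_le_mul (hrR i) (hsS i) (hs i).le (by linarith)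
    have h3 := mul_le_mul_of_nonneg_right (hrε i) (mul_nonneg hη.le (hw i).le)
    have h4 := mul_le_mul_of_nonneg_right h2 (hw i).le
    nlinarith
  have habs : |η * W - T| ≤ (2 ^ (k + 2) + 1) * R * S * W := by
    have hRSW : 0 < R * S * W := by positivity
    have hp : (0:ℝ) < 2 ^ (k + 1) := by positivity
    have hSW : S * W ≤ R * S * W := by nlinarith [mul_pos hS hW]
    rw [abs_le]
    constructor
    · rw [hεη] at hdown
      have : 2 ^ (k + 1) * (S * W) ≤ 2 ^ (k + 2) * (R * S * W) := by
        rw [pow_succ _ (k + 1)]; nlinarith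
      nlinarith
    · nlinarith
  rw [show η - T / W = (η * W - T) / W by field_simp, abs_div, abs_of_pos hW, div_le_iff₀ hW]
  exact habs

end CriticalPoint

/-! ### Distance O(1/N) between the minimizers and the quadratic ratios. -/

section RateBound

variable {n N : ℕ} {σ η B : ℝ} {Φ : Matrix (Fin N) (Fin n) ℝ} {Y : Fin N → ℝ}

/-- Least squares estimator. -/
noncomputable def lsEstimator {n N : ℕ} (Φ : Matrix (Fin N) (Fin n) ℝ) (Y : Fin N → ℝ) :
    Fin n → ℝ :=
  (Φᵀ * Φ)⁻¹ *ᵥ (Φᵀ *ᵥ Y)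

/-- The two trace bounds trap every eigenvalue mᵢ in [1/B, B]. Hence the perturbations σ²/(N mᵢ) are
at most S = σ²B/N and comparable to it with ratio ρ = B². The normal equations express UᵀΦᵀY through
the rotated least squares estimator. -/
lemma exists_spectral_data (hN : 0 < N) (hM : ((N : ℝ)⁻¹ • (Φᵀ * Φ)).PosDef)
    (hB : ((N : ℝ)⁻¹ • (Φᵀ * Φ)).trace ≤ B) (hB' : ((N : ℝ)⁻¹ • (Φᵀ * Φ))⁻¹.trace ≤ B) :
    ∃ (U : Matrix (Fin n) (Fin n) ℝ) (m : Fin n → ℝ),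
      U * Uᵀ = 1 ∧ Uᵀ * U = 1 ∧ (∀ i, 0 < m i) ∧ Φᵀ * Φ = specMatrix U (fun i => N * m i) ∧
      ((N : ℝ)⁻¹ • (Φᵀ * Φ))⁻¹ = specMatrix U m⁻¹ ∧
      (∀ i, (Uᵀ *ᵥ (Φᵀ *ᵥ Y)) i = N * m i * (Uᵀ *ᵥ lsEstimator Φ Y) i) ∧
      (∀ i, (m i)⁻¹ ≤ B) ∧ ∀ i, B ≤ B ^ 2 * (m i)⁻¹ := by
  obtain ⟨U, m, hU, hU', hm, hMU⟩ := exists_eq_specMatrix hM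
  have hN' : (0 : ℝ) < N := by exact_mod_cast hN
  have hG : Φᵀ * Φ = specMatrix U (fun i => N * m i) := by
    rw [inv_smul_eq_iff₀ hN'.ne', specMatrix_smul] at hMU
    exact hMU
  have hinv : ((N : ℝ)⁻¹ • (Φᵀ * Φ))⁻¹ = specMatrix U m⁻¹ := by
    rw [hMU, specMatrix_inv hU hU' fun i => (hm i).ne']
  rw [hinv, trace_specMatrix hU'] at hB'
  rw [hMU, trace_specMatrix hU'] at hB
  have h1 : ∀ i, (m i)⁻¹ ≤ B := fun i =>
    (Finset.single_le_sum (f := m⁻¹) (fun j _ => (inv_pos.2 (hm j)).le) (Finset.mem_univ i)).trans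
      hB'
  have h2 : ∀ i, m i ≤ B := fun i =>
    (Finset.single_le_sum (f := m) (fun j _ => (hm j).le) (Finset.mem_univ i)).trans hB
  refine ⟨U, m, hU, hU', hm, hG, hinv, fun i => ?_, h1, fun i => ?_⟩
  · have hpos : ∀ i, (fun i => N * m i) i ≠ 0 := fun i => (mul_pos hN' (hm i)).ne'
    rw [lsEstimator, hG, specMatrix_inv hU hU' hpos, transpose_mulVec_specMatrix_mulVec hU',
      Pi.inv_apply, mul_inv_cancel_left₀ (hpos i)]
  · have hmi := hm i
    have hBp : 0 < B := hmi.trans_le (h2 i)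
    rw [← div_eq_mul_inv, le_div_iff₀ hmi, sq]
    exact mul_le_mul_of_nonneg_left (h2 i) hBp.le

/-- Keeping `J` as a variable gives this bound and its SURE counterpart the common shape that
`tendsto_sqrt_mul_sub_ratio` consumes. -/
theorem abs_argmin_costEB_sub_le (hσ : 0 < σ) {H : Set ℝ} (hH : IsOpen H) (hpos : ∀ x ∈ H, 0 < x)
    (hmin : IsArgmin (fun x => costEB σ Φ Y (ridgeKernel n x)) H η)
    (hN : 0 < N) (hM : ((N : ℝ)⁻¹ • (Φᵀ * Φ)).PosDef)
    (hB : ((N : ℝ)⁻¹ • (Φᵀ * Φ)).trace ≤ B) (hB' : ((N : ℝ)⁻¹ • (Φᵀ * Φ))⁻¹.trace ≤ B)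
    {J : Matrix (Fin n) (Fin n) ℝ} (hJ : J = 1)
    (hT : 0 < lsEstimator Φ Y ⬝ᵥ (J *ᵥ lsEstimator Φ Y))
    (hsmall : 2 * (B ^ 2) ^ 2 * (σ ^ 2 * B / N) * J.trace ≤
      lsEstimator Φ Y ⬝ᵥ (J *ᵥ lsEstimator Φ Y)) :
    |η - lsEstimator Φ Y ⬝ᵥ (J *ᵥ lsEstimator Φ Y) / J.trace| ≤
      (2 ^ 3 + 1) * (B ^ 2) ^ 2 * (σ ^ 2 * B / N) := by
  obtain ⟨U, m, hU, hU', hm, hG, -, hz, hB1, hB2⟩ := exists_spectral_data (Y := Y) hN hM hB hB'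
  have hN' : (0 : ℝ) < N := by exact_mod_cast hN
  have hη := hpos η hmin.1
  have hcrit := costEB_critical hσ (fun i => mul_pos hN' (hm i)) hU hU' hG hH hpos hmin
  rw [← specMatrix_one hU] at hJ
  have hquad : ∀ x, x ⬝ᵥ (J *ᵥ x) = _ := fun x => hJ ▸ dotProduct_specMatrix_mulVec 1 x
  have htr : J.trace = _ := hJ ▸ trace_specMatrix hU' 1
  rw [hquad] at hT
  rw [hquad, htr] at hsmall ⊢
  -- Dividing by g = N m turns each denominator ηg + σ² into η + s.
  refine abs_root_sub_weightedMean_le 1 (w := 1) (s := fun i => σ ^ 2 * (m i)⁻¹ / N) (ρ := B ^ 2)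
    (fun _ => one_pos) (fun i => sq_nonneg _) (fun i => ?_) hη (fun i => ?_) (fun i => ?_) ?_ hT
    hsmall
  · have := hm i
    positivity
  · have := hB1 i
    gcongr
  · calc σ ^ 2 * B / N ≤ σ ^ 2 * (B ^ 2 * (m i)⁻¹) / N := by
          have := hB2 i
          gcongr
      _ = _ := by ring
  · convert hcrit using 2 with i _ i _
    · have := hm i
      simp only [Pi.one_apply]
      field_simp
    · have := hm i
      rw [hz]
      simp only [Pi.one_apply, Nat.reduceAdd]
      field_simp

theorem abs_argmin_costSy_sub_le (hσ : 0 < σ) {H : Set ℝ} (hH : IsOpen H) (hpos : ∀ x ∈ H, 0 < x)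
    (hmin : IsArgmin (fun x => costSy σ Φ Y (ridgeKernel n x)) H η)
    (hN : 0 < N) (hM : ((N : ℝ)⁻¹ • (Φᵀ * Φ)).PosDef)
    (hB : ((N : ℝ)⁻¹ • (Φᵀ * Φ)).trace ≤ B) (hB' : ((N : ℝ)⁻¹ • (Φᵀ * Φ))⁻¹.trace ≤ B)
    {J : Matrix (Fin n) (Fin n) ℝ} (hJ : J = ((N : ℝ)⁻¹ • (Φᵀ * Φ))⁻¹)
    (hT : 0 < lsEstimator Φ Y ⬝ᵥ (J *ᵥ lsEstimator Φ Y))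
    (hsmall : 2 * (B ^ 2) ^ 3 * (σ ^ 2 * B / N) * J.trace ≤
      lsEstimator Φ Y ⬝ᵥ (J *ᵥ lsEstimator Φ Y)) :
    |η - lsEstimator Φ Y ⬝ᵥ (J *ᵥ lsEstimator Φ Y) / J.trace| ≤
      (2 ^ 4 + 1) * (B ^ 2) ^ 3 * (σ ^ 2 * B / N) := by
  obtain ⟨U, m, hU, hU', hm, hG, hinv, hz, hB1, hB2⟩ := exists_spectral_data (Y := Y) hN hM hB hB'
  have hN' : (0 : ℝ) < N := by exact_mod_cast hN
  have hη := hpos η hmin.1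
  have hcrit := costSy_critical hσ (fun i => mul_pos hN' (hm i)) hU hU' hG hH hpos hmin
  rw [hinv] at hJ
  have hquad : ∀ x, x ⬝ᵥ (J *ᵥ x) = _ := fun x => hJ ▸ dotProduct_specMatrix_mulVec m⁻¹ x
  have htr : J.trace = _ := hJ ▸ trace_specMatrix hU' m⁻¹
  rw [hquad] at hT
  rw [hquad, htr] at hsmall ⊢
  refine abs_root_sub_weightedMean_le 2 (w := m⁻¹) (s := fun i => σ ^ 2 * (m i)⁻¹ / N)
    (ρ := B ^ 2)
    (fun i => inv_pos.2 (hm i)) (fun i => sq_nonneg _) (fun i => ?_) hη (fun i => ?_)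
    (fun i => ?_) ?_ hT hsmall
  · have := hm i
    positivity
  · have := hB1 i
    gcongr
  · calc σ ^ 2 * B / N ≤ σ ^ 2 * (B ^ 2 * (m i)⁻¹) / N := by
          have := hB2 i
          gcongr
      _ = _ := by ring
  -- Here one factor 1/(N mᵢ) survives on each side. Multiplying by N leaves the weights 1/mᵢ.
  · have h := congrArg (fun z => (N : ℝ) * z) hcrit
    simp only [Finset.mul_sum] at h
    convert h using 2 with i _ i _
    · have := hm i
      simp only [Pi.inv_apply]
      field_simp
    · have := hm i
      rw [hz]
      simp only [Pi.inv_apply, Nat.reduceAdd]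
      field_simp

end RateBound

/-! ### Continuity and measurability of matrix operations. -/

section MatrixLimits

variable {n : ℕ} {α : Type*} {l : Filter α}

lemma tendsto_matrix_inv {M : α → Matrix (Fin n) (Fin n) ℝ} {S : Matrix (Fin n) (Fin n) ℝ}
    (hS : IsUnit S) (h : Tendsto M l (𝓝 S)) : Tendsto (fun x => (M x)⁻¹) l (𝓝 S⁻¹) := by
  have hdet : S.det ≠ 0 := ((Matrix.isUnit_iff_isUnit_det _).1 hS).ne_zero
  have hc : ContinuousAt Ring.inverse S.det := by
    rw [Ring.inverse_eq_inv']
    exact continuousAt_inv₀ hdet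
  exact (continuousAt_matrix_inv S hc).tendsto.comp h

lemma eventually_isUnit_of_tendsto {M : α → Matrix (Fin n) (Fin n) ℝ}
    {S : Matrix (Fin n) (Fin n) ℝ} (hS : IsUnit S) (h : Tendsto M l (𝓝 S)) :
    ∀ᶠ x in l, IsUnit (M x) := by
  have hdet : S.det ≠ 0 := ((Matrix.isUnit_iff_isUnit_det _).1 hS).ne_zero
  have h1 : Tendsto (fun x => (M x).det) l (𝓝 S.det) :=
    (continuous_id.matrix_det.tendsto S).comp h
  filter_upwards [h1.eventually_ne hdet] with x hx
  exact (Matrix.isUnit_iff_isUnit_det _).2 hx.isUnit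

lemma tendsto_matrix_of_apply {M : α → Matrix (Fin n) (Fin n) ℝ} {S : Matrix (Fin n) (Fin n) ℝ}
    (h : ∀ i j, Tendsto (fun x => M x i j) l (𝓝 (S i j))) : Tendsto M l (𝓝 S) :=
  tendsto_pi_nhds.2 fun i => tendsto_pi_nhds.2 fun j => h i j

lemma tendsto_trace {M : α → Matrix (Fin n) (Fin n) ℝ} {S : Matrix (Fin n) (Fin n) ℝ}
    (h : Tendsto M l (𝓝 S)) : Tendsto (fun x => (M x).trace) l (𝓝 S.trace) :=
  (continuous_id.matrix_trace.tendsto S).comp h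

lemma tendsto_mulVec {M : α → Matrix (Fin n) (Fin n) ℝ} {S : Matrix (Fin n) (Fin n) ℝ}
    (h : Tendsto M l (𝓝 S)) {x : α → Fin n → ℝ} {z : Fin n → ℝ} (hx : Tendsto x l (𝓝 z)) :
    Tendsto (fun i => M i *ᵥ x i) l (𝓝 (S *ᵥ z)) := by
  have hc : Continuous fun p : Matrix (Fin n) (Fin n) ℝ × (Fin n → ℝ) => p.1 *ᵥ p.2 :=
    continuous_fst.matrix_mulVec continuous_snd
  exact (hc.tendsto (S, z)).comp (h.prodMk_nhds hx)

lemma tendsto_dotProduct {x y : α → Fin n → ℝ} {z w : Fin n → ℝ} (hx : Tendsto x l (𝓝 z))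
    (hy : Tendsto y l (𝓝 w)) : Tendsto (fun i => x i ⬝ᵥ y i) l (𝓝 (z ⬝ᵥ w)) := by
  have hc : Continuous fun p : (Fin n → ℝ) × (Fin n → ℝ) => p.1 ⬝ᵥ p.2 :=
    continuous_fst.dotProduct continuous_snd
  exact (hc.tendsto (z, w)).comp (hx.prodMk_nhds hy)

/-- Inversion is not continuous at singular matrices, but adjugate over determinant is measurable
everywhere, with the convention 0⁻¹ = 0. -/
lemma measurable_matrix_inv_apply {E : Type*} [MeasurableSpace E]
    {M : E → Matrix (Fin n) (Fin n) ℝ} (hM : ∀ i j, Measurable fun x => M x i j) (i j : Fin n) :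
    Measurable fun x => (M x)⁻¹ i j := by
  have hm : Measurable fun x => (fun i j => M x i j : Fin n → Fin n → ℝ) :=
    measurable_pi_lambda _ fun i => measurable_pi_lambda _ fun j => hM i j
  have h1 : Continuous fun A : Fin n → Fin n → ℝ => (Matrix.of A).det :=
    Continuous.matrix_det (A := fun A : Fin n → Fin n → ℝ => Matrix.of A) continuous_id
  have h2 : Continuous fun A : Fin n → Fin n → ℝ => (Matrix.of A).adjugate i j :=
    (Continuous.matrix_adjugate (A := fun A : Fin n → Fin n → ℝ => Matrix.of A)
      continuous_id).matrix_elem i j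
  have h3 := ((h1.measurable.comp hm).inv).mul (h2.measurable.comp hm)
  have e : (fun x => (M x)⁻¹ i j) = fun x => (M x).det⁻¹ * (M x).adjugate i j := by
    ext x
    simp only [Matrix.inv_def, Ring.inverse_eq_inv', Matrix.smul_apply, smul_eq_mul]
  rw [e]
  exact h3

end MatrixLimits

/-! ### The least squares error as a linear function of the noise. -/

section Regression

variable {n : ℕ}

/-- Normalized Gram matrix `ΦᵀΦ / N`. -/
noncomputable def gram (f : ℕ → Fin n → ℝ) (N : ℕ) : Matrix (Fin n) (Fin n) ℝ :=
  (N : ℝ)⁻¹ • ((regMatrix f N)ᵀ * regMatrix f N)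

/-- Normalized least squares error `√N (ΦᵀΦ)⁻¹ Φᵀ V`. -/
noncomputable def scaledError (f : ℕ → Fin n → ℝ) (v : ℕ → ℝ) (N : ℕ) : Fin n → ℝ :=
  (√(N : ℝ))⁻¹ • ((gram f N)⁻¹ *ᵥ ((regMatrix f N)ᵀ *ᵥ fun t : Fin N => v t))

lemma measurable_gram_apply (N : ℕ) (i j : Fin n) : Measurable fun f => gram f N i j := by
  simp only [gram, Matrix.smul_apply, Matrix.mul_apply, Matrix.transpose_apply, regMatrix,
    Matrix.of_apply, smul_eq_mul]
  fun_prop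

lemma gram_transpose (f : ℕ → Fin n → ℝ) (N : ℕ) : (gram f N)ᵀ = gram f N := by
  simp [gram, Matrix.transpose_smul, Matrix.transpose_mul]

lemma gram_inv_transpose (f : ℕ → Fin n → ℝ) (N : ℕ) : ((gram f N)⁻¹)ᵀ = (gram f N)⁻¹ := by
  rw [Matrix.transpose_nonsing_inv, gram_transpose]

lemma gram_posDef {f : ℕ → Fin n → ℝ} {N : ℕ} (h : IsUnit (gram f N)) : (gram f N).PosDef := by
  have h1 := Matrix.posSemidef_conjTranspose_mul_self (regMatrix f N)
  rw [conjTranspose_eq_transpose_of_trivial] at h1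
  have h2 : (gram f N).PosSemidef := h1.smul (inv_nonneg.2 (Nat.cast_nonneg N))
  exact h2.posDef_iff_isUnit.2 h

lemma lsEstimator_outputVec {f : ℕ → Fin n → ℝ} {N : ℕ} (hN : 0 < N) (h : IsUnit (gram f N))
    (v : ℕ → ℝ) (θ₀ : Fin n → ℝ) :
    lsEstimator (regMatrix f N) (outputVec f v θ₀ N) =
      θ₀ + (√(N : ℝ))⁻¹ • scaledError f v N := by
  have hN' : (0 : ℝ) < N := by exact_mod_cast hN
  set Φ := regMatrix f N
  have hG : Φᵀ * Φ = (N : ℝ) • gram f N := by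
    rw [gram, smul_inv_smul₀ hN'.ne']
  have hdet : IsUnit (gram f N).det := (Matrix.isUnit_iff_isUnit_det _).1 h
  have hinv : (Φᵀ * Φ)⁻¹ = (N : ℝ)⁻¹ • (gram f N)⁻¹ := by
    refine Matrix.inv_eq_right_inv ?_
    rw [hG, Matrix.smul_mul, Matrix.mul_smul, Matrix.mul_nonsing_inv _ hdet, smul_smul,
      mul_inv_cancel₀ hN'.ne', one_smul]
  have hs : (√(N : ℝ))⁻¹ * (√(N : ℝ))⁻¹ = (N : ℝ)⁻¹ := by
    rw [← mul_inv, Real.mul_self_sqrt hN'.le]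
  have hY : outputVec f v θ₀ N = Φ *ᵥ θ₀ + fun t : Fin N => v t := rfl
  rw [lsEstimator, hY, mulVec_add, mulVec_add, hinv, scaledError, smul_smul, hs]
  congr 1
  · rw [mulVec_mulVec θ₀ Φᵀ Φ, hG, smul_mulVec, smul_mulVec, mulVec_smul, mulVec_mulVec,
      Matrix.nonsing_inv_mul _ hdet, one_mulVec, smul_smul, inv_mul_cancel₀ hN'.ne', one_smul]
  · rw [smul_mulVec]

/-- Weights of the noise in `a ⬝ scaledError`. -/
noncomputable def noiseWeights (f : ℕ → Fin n → ℝ) (N : ℕ) (a : Fin n → ℝ) : Fin N → ℝ :=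
  (√(N : ℝ))⁻¹ • (regMatrix f N *ᵥ ((gram f N)⁻¹ *ᵥ a))

/-- Moving everything onto `a` leaves weights that depend on the regressors alone, the form required
by `tendstoInDistribution_sum_mul_gaussian`. -/
lemma dotProduct_scaledError (f : ℕ → Fin n → ℝ) (v : ℕ → ℝ) (N : ℕ) (a : Fin n → ℝ) :
    a ⬝ᵥ scaledError f v N = ∑ t, noiseWeights f N a t * v t := by
  change _ = noiseWeights f N a ⬝ᵥ fun t : Fin N => v t
  rw [scaledError, noiseWeights, dotProduct_smul, smul_dotProduct, dotProduct_mulVec,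
    ← mulVec_transpose, gram_inv_transpose, dotProduct_mulVec, vecMul_transpose]

/-- Up to σ² this is the conditional variance: one `gram` cancels one of its two inverses. -/
lemma sum_noiseWeights_sq {f : ℕ → Fin n → ℝ} {N : ℕ} (h : IsUnit (gram f N))
    (a : Fin n → ℝ) : ∑ t, noiseWeights f N a t ^ 2 = a ⬝ᵥ ((gram f N)⁻¹ *ᵥ a) := by
  have hdet : IsUnit (gram f N).det := (Matrix.isUnit_iff_isUnit_det _).1 h
  have hs : (√(N : ℝ))⁻¹ * (√(N : ℝ))⁻¹ = (N : ℝ)⁻¹ := by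
    rw [← mul_inv, Real.mul_self_sqrt (Nat.cast_nonneg N)]
  have e : ∑ t, noiseWeights f N a t ^ 2 = noiseWeights f N a ⬝ᵥ noiseWeights f N a :=
    Finset.sum_congr rfl fun t _ => sq _
  set b := (gram f N)⁻¹ *ᵥ a with hb
  rw [e, noiseWeights, dotProduct_smul, smul_dotProduct, smul_smul, hs, ← hb,
    ← vecMul_transpose (regMatrix f N) b, ← dotProduct_mulVec, vecMul_transpose, mulVec_mulVec,
    ← dotProduct_smul, ← smul_mulVec]
  change b ⬝ᵥ (gram f N *ᵥ b) = _
  rw [hb, mulVec_mulVec a, Matrix.mul_nonsing_inv _ hdet, one_mulVec, dotProduct_comm]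

lemma measurable_noiseWeights (N : ℕ) {a : (ℕ → Fin n → ℝ) → Fin n → ℝ}
    (ha : Measurable a) : Measurable fun f => noiseWeights f N (a f) := by
  refine measurable_pi_lambda _ fun t => ?_
  simp only [noiseWeights, Pi.smul_apply, smul_eq_mul, mulVec, dotProduct, regMatrix,
    Matrix.of_apply]
  refine Measurable.const_mul (Finset.measurable_sum _ fun i _ => Measurable.mul (by fun_prop)
    (Finset.measurable_sum _ fun j _ => Measurable.mul ?_ ((measurable_pi_apply j).comp ha))) _
  exact measurable_matrix_inv_apply (fun i j => measurable_gram_apply N i j) i j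

end Regression

/-! ### Asymptotic normality of quadratic ratios in the least squares estimator. -/

section AsymptoticNormality

variable {Ω : Type*} [MeasurableSpace Ω] {μ : Measure Ω} [IsProbabilityMeasure μ]
  {n : ℕ} {σ : ℝ} {φ : ℕ → Ω → Fin n → ℝ} {v : ℕ → Ω → ℝ} {Sig : Matrix (Fin n) (Fin n) ℝ}

lemma measurable_regressors (hφ_meas : ∀ t, Measurable (φ t)) : Measurable fun ω t => φ t ω :=
  measurable_pi_lambda _ hφ_meas

lemma tendsto_probFilter_matrix {J : ℕ → Ω → Matrix (Fin n) (Fin n) ℝ}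
    {J₀ : Matrix (Fin n) (Fin n) ℝ} (hJ : ∀ N i j, Measurable fun ω => J N ω i j)
    (h : ∀ᵐ ω ∂μ, Tendsto (fun N => J N ω) atTop (𝓝 J₀)) :
    Tendsto (fun x : ℕ × Ω => J x.1 x.2) (probFilter μ) (𝓝 J₀) := by
  refine tendsto_matrix_of_apply fun i j => ?_
  refine tendsto_probFilter_of_ae (X := fun N ω => J N ω i j) (fun N => hJ N i j) ?_
  filter_upwards [h] with ω hω
  exact ((continuous_id.matrix_elem i j).tendsto J₀).comp hω

/-- Letting `a` vary with N and the regressors accommodates the random coefficient 2Jθ₀ / Tr J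
directly. -/
theorem tendstoInDistribution_dotProduct_scaledError
    (hφ_meas : ∀ t, Measurable (φ t)) (hv_meas : ∀ t, Measurable (v t))
    (hv_law : ∀ t, μ.map (v t) = gaussianReal 0 (Real.toNNReal (σ ^ 2)))
    (hv_indep : iIndepFun v μ) (hφv : IndepFun (fun ω t => φ t ω) (fun ω t => v t ω) μ)
    (hSig : IsUnit Sig)
    (hconv : ∀ᵐ ω ∂μ, Tendsto (fun N => gram (fun t => φ t ω) N) atTop (𝓝 Sig))
    {a : ℕ → (ℕ → Fin n → ℝ) → Fin n → ℝ} (ha : ∀ N, Measurable (a N)) {a₀ : Fin n → ℝ}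
    (hlim : ∀ᵐ ω ∂μ, Tendsto (fun N => a N (fun t => φ t ω)) atTop (𝓝 a₀)) :
    TendstoInDistribution (fun N ω => a N (fun t => φ t ω) ⬝ᵥ
        scaledError (fun t => φ t ω) (fun t => v t ω) N) atTop (id : ℝ → ℝ)
      (fun _ => μ) (gaussianReal 0 (Real.toNNReal (σ ^ 2 * (a₀ ⬝ᵥ (Sig⁻¹ *ᵥ a₀))))) := by
  simp only [dotProduct_scaledError]
  refine tendstoInDistribution_sum_mul_gaussian (measurable_regressors hφ_meas) hv_meas hv_law
    hv_indep hφv (fun N f => noiseWeights f N (a N f))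
    (fun N => measurable_noiseWeights N (ha N)) ?_
  filter_upwards [hconv, hlim] with ω h1 h2
  refine (tendsto_dotProduct h2 (tendsto_mulVec (tendsto_matrix_inv hSig h1) h2)).congr' ?_
  filter_upwards [eventually_isUnit_of_tendsto hSig h1] with N hN
  exact (sum_noiseWeights_sq hN _).symm

lemma tendsto_inv_sqrt_sqrt_nat : Tendsto (fun N : ℕ => (√√(N : ℝ))⁻¹) atTop (𝓝 0) :=
  tendsto_inv_atTop_zero.comp (Real.tendsto_sqrt_atTop.comp
    (Real.tendsto_sqrt_atTop.comp tendsto_natCast_atTop_atTop))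

/-- The factor is N^(-1/4), so that N^(-1/2) eᵀJe is a quadratic form in a vector tending to zero.
Each coordinate is the limit theorem with direction N^(-1/4) times a basis vector, whose limiting
variance is 0. -/
lemma tendsto_smul_scaledError_zero
    (hφ_meas : ∀ t, Measurable (φ t)) (hv_meas : ∀ t, Measurable (v t))
    (hv_law : ∀ t, μ.map (v t) = gaussianReal 0 (Real.toNNReal (σ ^ 2)))
    (hv_indep : iIndepFun v μ) (hφv : IndepFun (fun ω t => φ t ω) (fun ω t => v t ω) μ)
    (hSig : IsUnit Sig)
    (hconv : ∀ᵐ ω ∂μ, Tendsto (fun N => gram (fun t => φ t ω) N) atTop (𝓝 Sig)) :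
    Tendsto (fun x : ℕ × Ω => (√√(x.1 : ℝ))⁻¹ •
      scaledError (fun t => φ t x.2) (fun t => v t x.2) x.1) (probFilter μ) (𝓝 0) := by
  refine tendsto_pi_nhds.2 fun i => ?_
  have h := tendstoInDistribution_dotProduct_scaledError hφ_meas hv_meas hv_law hv_indep hφv hSig
    hconv (a := fun N _ => (√√(N : ℝ))⁻¹ • Pi.single i 1) (a₀ := 0) (fun N => measurable_const)
    (ae_of_all _ fun ω => by
      simpa using tendsto_inv_sqrt_sqrt_nat.smul_const (Pi.single i 1 : Fin n → ℝ))
  simp only [zero_dotProduct, mul_zero, Real.toNNReal_zero] at h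
  refine (tendsto_probFilter_of_tendstoInDistribution_zero h).congr fun x => ?_
  simp [smul_dotProduct]

/-- Asymptotic normality of an estimator that is asymptotically equivalent to the ratio
`θᵀ J θ / Tr J`, where `θ` is the least squares estimator. -/
theorem tendstoInDistribution_of_quadratic_ratio
    (hφ_meas : ∀ t, Measurable (φ t)) (hv_meas : ∀ t, Measurable (v t))
    (hv_law : ∀ t, μ.map (v t) = gaussianReal 0 (Real.toNNReal (σ ^ 2)))
    (hv_indep : iIndepFun v μ) (hφv : IndepFun (fun ω t => φ t ω) (fun ω t => v t ω) μ)
    (hSig : IsUnit Sig)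
    (hconv : ∀ᵐ ω ∂μ, Tendsto (fun N => gram (fun t => φ t ω) N) atTop (𝓝 Sig))
    (θ₀ : Fin n → ℝ) {J : ℕ → (ℕ → Fin n → ℝ) → Matrix (Fin n) (Fin n) ℝ}
    {J₀ : Matrix (Fin n) (Fin n) ℝ} (hJm : ∀ N i j, Measurable fun f => J N f i j)
    (hJsymm : ∀ N f, (J N f)ᵀ = J N f)
    (hJ : ∀ᵐ ω ∂μ, Tendsto (fun N => J N (fun t => φ t ω)) atTop (𝓝 J₀))
    (hJrate : Tendsto (fun x : ℕ × Ω => √(x.1 : ℝ) • (J x.1 (fun t => φ t x.2) - J₀))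
      (probFilter μ) (𝓝 0))
    (htr : J₀.trace ≠ 0) {η : ℕ → Ω → ℝ} (hη : ∀ N, Measurable (η N))
    (hlin : Tendsto (fun x : ℕ × Ω => √(x.1 : ℝ) * (η x.1 x.2 -
      lsEstimator (regMatrix (fun t => φ t x.2) x.1)
          (outputVec (fun t => φ t x.2) (fun t => v t x.2) θ₀ x.1) ⬝ᵥ
        (J x.1 (fun t => φ t x.2) *ᵥ lsEstimator (regMatrix (fun t => φ t x.2) x.1)
          (outputVec (fun t => φ t x.2) (fun t => v t x.2) θ₀ x.1)) /
        (J x.1 (fun t => φ t x.2)).trace)) (probFilter μ) (𝓝 0)) :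
    TendstoInDistribution
      (fun (N : ℕ) ω => √(N : ℝ) * (η N ω - θ₀ ⬝ᵥ (J₀ *ᵥ θ₀) / J₀.trace)) atTop (id : ℝ → ℝ)
      (fun _ => μ) (gaussianReal 0 (Real.toNNReal (σ ^ 2 *
        (((2 / J₀.trace) • (J₀ *ᵥ θ₀)) ⬝ᵥ (Sig⁻¹ *ᵥ ((2 / J₀.trace) • (J₀ *ᵥ θ₀))))))) := by
  have hφm := measurable_regressors hφ_meas
  have htrm : ∀ N, Measurable fun f => (J N f).trace := fun N => by
    simp only [Matrix.trace, Matrix.diag]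
    exact Finset.measurable_sum _ fun i _ => hJm N i i
  have ham : ∀ N, Measurable fun f => (2 / (J N f).trace) • (J N f *ᵥ θ₀) := fun N => by
    refine measurable_pi_lambda _ fun i => ?_
    simp only [Pi.smul_apply, smul_eq_mul, mulVec, dotProduct]
    exact ((htrm N).const_div 2).mul
      (Finset.measurable_sum _ fun j _ => (hJm N i j).mul_const _)
  have hclt := tendstoInDistribution_dotProduct_scaledError hφ_meas hv_meas hv_law hv_indep hφv
    hSig hconv (a := fun N f => (2 / (J N f).trace) • (J N f *ᵥ θ₀)) ham
    (a₀ := (2 / J₀.trace) • (J₀ *ᵥ θ₀)) (by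
      filter_upwards [hJ] with ω hω
      exact ((tendsto_const_nhds.div (tendsto_trace hω) htr).smul
        (tendsto_mulVec hω tendsto_const_nhds)))
  refine tendstoInDistribution_of_tendstoInMeasure_sub _ _ hclt ?_
    fun N => (((hη N).sub_const _).const_mul _).aemeasurable
  change TendstoInMeasure μ _ atTop (fun _ => (0 : ℝ))
  rw [tendstoInMeasure_iff_probFilter]
  have hJl := tendsto_probFilter_matrix (μ := μ) (J := fun N ω => J N fun t => φ t ω)
    (fun N i j => (hJm N i j).comp hφm) hJ
  have hgl := tendsto_probFilter_matrix (μ := μ) (J := fun N ω => gram (fun t => φ t ω) N)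
    (fun N i j => (measurable_gram_apply N i j).comp hφm) hconv
  have hql := tendsto_smul_scaledError_zero hφ_meas hv_meas hv_law hv_indep hφv hSig hconv
  have htl := tendsto_trace hJl
  -- The remainders are: the error of `hlin`, the quadratic term in e, and the change from J to J₀,
  -- written as (θ₀ᵀ(J-J₀)θ₀ - (θ₀ᵀJ₀θ₀ / Tr J₀) Tr(J-J₀)) / Tr J.
  have hmain := (hlin.add ((tendsto_dotProduct hql (tendsto_mulVec hJl hql)).div htl htr)).add
    (((tendsto_dotProduct (tendsto_const_nhds (x := θ₀)) (tendsto_mulVec hJrate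
      (tendsto_const_nhds (x := θ₀)))).sub
      ((tendsto_trace hJrate).const_mul (θ₀ ⬝ᵥ (J₀ *ᵥ θ₀) / J₀.trace))).div htl htr)
  simp only [mulVec_zero, zero_mulVec, dotProduct_zero, trace_zero, mul_zero, sub_zero, zero_div,
    add_zero] at hmain
  refine hmain.congr' ?_
  filter_upwards [htl.eventually_ne htr, eventually_isUnit_of_tendsto hSig hgl,
    tendsto_fst_probFilter.eventually (eventually_gt_atTop 0)] with x hx1 hx2 hx3
  have hN' : (0 : ℝ) < x.1 := by exact_mod_cast hx3
  simp only [Pi.sub_apply, Pi.div_apply, lsEstimator_outputVec hx3 hx2]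
  set e := scaledError (fun t => φ t x.2) (fun t => v t x.2) x.1
  have hsym := hJsymm x.1 fun t => φ t x.2
  set A := J x.1 fun t => φ t x.2
  set s := √(x.1 : ℝ) with hs
  have hs0 : 0 < s := Real.sqrt_pos.2 hN'
  have hss : (√s)⁻¹ * (√s)⁻¹ = s⁻¹ := by
    rw [← mul_inv, Real.mul_self_sqrt hs0.le]
  have hcomm : e ⬝ᵥ (A *ᵥ θ₀) = θ₀ ⬝ᵥ (A *ᵥ e) := by
    rw [dotProduct_mulVec, ← mulVec_transpose, hsym, dotProduct_comm]
  have e1 : (θ₀ + s⁻¹ • e) ⬝ᵥ (A *ᵥ (θ₀ + s⁻¹ • e)) =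
      θ₀ ⬝ᵥ (A *ᵥ θ₀) + 2 * s⁻¹ * (e ⬝ᵥ (A *ᵥ θ₀)) + s⁻¹ * s⁻¹ * (e ⬝ᵥ (A *ᵥ e)) := by
    simp only [mulVec_add, mulVec_smul, add_dotProduct, dotProduct_add, smul_dotProduct,
      dotProduct_smul, smul_eq_mul, hcomm]
    ring
  have e2 : ((√s)⁻¹ • e) ⬝ᵥ (A *ᵥ ((√s)⁻¹ • e)) = s⁻¹ * (e ⬝ᵥ (A *ᵥ e)) := by
    simp only [mulVec_smul, smul_dotProduct, dotProduct_smul, smul_eq_mul]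
    rw [← hss]
    ring
  have e3 : ((2 / A.trace) • (A *ᵥ θ₀)) ⬝ᵥ e = 2 / A.trace * (e ⬝ᵥ (A *ᵥ θ₀)) := by
    rw [smul_dotProduct, dotProduct_comm, smul_eq_mul]
  have e4 : θ₀ ⬝ᵥ ((s • (A - J₀)) *ᵥ θ₀) = s * (θ₀ ⬝ᵥ (A *ᵥ θ₀) - θ₀ ⬝ᵥ (J₀ *ᵥ θ₀)) := by
    simp only [smul_mulVec, sub_mulVec, dotProduct_smul, dotProduct_sub, smul_eq_mul]
  have e5 : (s • (A - J₀)).trace = s * (A.trace - J₀.trace) := by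
    simp only [trace_smul, trace_sub, smul_eq_mul]
  rw [e1, e2, e3, e4, e5]
  field_simp
  ring

end AsymptoticNormality

/-! ### Critical points of the limit costs. -/

section LimitCosts

variable {n : ℕ} {σ η : ℝ} {θ₀ : Fin n → ℝ} {Sig : Matrix (Fin n) (Fin n) ℝ} {H : Set ℝ}

lemma ridgeKernel_inv (hη : η ≠ 0) : (ridgeKernel n η)⁻¹ = η⁻¹ • 1 := by
  refine Matrix.inv_eq_right_inv ?_
  rw [ridgeKernel, Matrix.smul_mul, Matrix.one_mul, smul_smul, mul_inv_cancel₀ hη, one_smul]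

lemma limitEB_critical (hH : IsOpen H) (hpos : ∀ x ∈ H, 0 < x)
    (hmin : IsArgmin (fun x => limitEB θ₀ (ridgeKernel n x)) H η) :
    θ₀ ⬝ᵥ ((1 : Matrix (Fin n) (Fin n) ℝ) *ᵥ θ₀) =
      η * (1 : Matrix (Fin n) (Fin n) ℝ).trace := by
  have hη := hpos η hmin.1
  have hF : ∀ y : ℝ, 0 < y → limitEB θ₀ (ridgeKernel n y) =
      y⁻¹ * (θ₀ ⬝ᵥ θ₀) + n * Real.log y := fun y hy => by
    rw [limitEB, ridgeKernel_inv hy.ne', smul_mulVec, one_mulVec, dotProduct_smul, smul_eq_mul,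
      ridgeKernel, det_smul, det_one, mul_one, Fintype.card_fin, Real.log_pow]
  have h0 := hmin.deriv_eq_zero hH hpos hF
    (((hasDerivAt_inv hη.ne').mul_const _).add ((Real.hasDerivAt_log hη.ne').const_mul _))
  rw [one_mulVec, trace_one, Fintype.card_fin]
  field_simp at h0
  linarith

/-- On the ridge family the limit cost is a quadratic polynomial in 1/η. The equation identifies η*
with the limiting ratio θ₀ᵀJ₀θ₀ / Tr J₀. -/
lemma limitSy_critical (hσ : 0 < σ) (hH : IsOpen H) (hpos : ∀ x ∈ H, 0 < x)
    (hmin : IsArgmin (fun x => limitSy σ Sig θ₀ (ridgeKernel n x)) H η) :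
    θ₀ ⬝ᵥ (Sig⁻¹ *ᵥ θ₀) = η * Sig⁻¹.trace := by
  have hη := hpos η hmin.1
  have hF : ∀ y : ℝ, 0 < y → limitSy σ Sig θ₀ (ridgeKernel n y) =
      (y⁻¹) ^ 2 * (σ ^ 4 * (θ₀ ⬝ᵥ (Sig⁻¹ *ᵥ θ₀))) - y⁻¹ * (2 * σ ^ 4 * Sig⁻¹.trace) :=
    fun y hy => by
      rw [limitSy, ridgeKernel_inv hy.ne', transpose_smul, transpose_one]
      simp only [Matrix.smul_mul, Matrix.mul_smul, Matrix.one_mul, Matrix.mul_one, smul_mulVec,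
        dotProduct_smul, trace_smul, smul_eq_mul]
      ring
  have h0 := hmin.deriv_eq_zero hH hpos hF
    ((((hasDerivAt_inv hη.ne').pow 2).mul_const _).sub ((hasDerivAt_inv hη.ne').mul_const _))
  simp only [Nat.add_one_sub_one, pow_one, Nat.cast_ofNat] at h0
  field_simp at h0
  rw [mul_zero] at h0
  have := (mul_eq_zero.1 h0).resolve_left (by positivity)
  linarith

end LimitCosts

/-! ### From the stochastic rate to negligibility at scale √N. -/

section Rate

lemma abs_apply_le_frobNorm {n : ℕ} (A : Matrix (Fin n) (Fin n) ℝ) (i j : Fin n) :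
    |A i j| ≤ frobNorm A := by
  rw [frobNorm]
  refine Real.abs_le_sqrt ?_
  exact (Finset.single_le_sum (f := fun j => A i j ^ 2) (fun _ _ => sq_nonneg _)
    (Finset.mem_univ j)).trans (Finset.single_le_sum (f := fun i => ∑ j, A i j ^ 2)
      (fun _ _ => Finset.sum_nonneg fun _ _ => sq_nonneg _) (Finset.mem_univ i))

lemma tendsto_sqrt_mul_of_isBigOInProb {Ω : Type*} [MeasurableSpace Ω] {μ : Measure Ω}
    {ξ : ℕ → Ω → ℝ} {δ : ℕ → ℝ} (hδ : ∀ N, 0 < δ N)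
    (hξ : IsBigOInProb μ ξ δ) (ho : δ =o[atTop] fun N : ℕ => 1 / √(N : ℝ)) :
    Tendsto (fun x : ℕ × Ω => √(x.1 : ℝ) * ξ x.1 x.2) (probFilter μ) (𝓝 0) := by
  rw [Metric.tendsto_nhds]
  intro ε hε
  rw [eventually_probFilter, ENNReal.tendsto_nhds_zero]
  intro ε' hε'
  obtain ⟨r, hr0, hr⟩ : ∃ r : ℝ, 0 < r ∧ ENNReal.ofReal r ≤ ε' := by
    obtain ⟨q, hq0, hq⟩ := ENNReal.lt_iff_exists_nnreal_btwn.1 hε'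
    exact ⟨q, by exact_mod_cast hq0, by rw [ENNReal.ofReal_coe_nnreal]; exact hq.le⟩
  obtain ⟨L, hL, hLb⟩ := hξ r hr0
  -- With δ ≤ ε/(2L√N), the event |ξ| ≤ Lδ forces √N|ξ| ≤ ε/2.
  have hc : 0 < ε / (2 * L) := by positivity
  filter_upwards [ho.bound hc, eventually_ge_atTop 1] with N hN1 hN2
  refine (measure_mono ?_).trans ((hLb N hN2).le.trans hr)
  intro ω hω
  by_contra hcon
  refine hω ?_
  simp only [Set.mem_ofPred_eq, not_lt] at hcon
  have hN' : (0 : ℝ) < N := by exact_mod_cast hN2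
  have hs : 0 < √(N : ℝ) := Real.sqrt_pos.2 hN'
  rw [Real.norm_eq_abs, Real.norm_eq_abs, abs_of_pos (hδ N), abs_of_pos (by positivity)] at hN1
  rw [abs_div, abs_of_pos (hδ N), div_le_iff₀ (hδ N)] at hcon
  rw [dist_zero_right, Real.norm_eq_abs, abs_mul, abs_of_pos hs]
  calc √(N : ℝ) * |ξ N ω| ≤ √(N : ℝ) * (L * (ε / (2 * L) * (1 / √(N : ℝ)))) := by
        gcongr
        exact hcon.trans (by gcongr)
    _ = ε / 2 := by field_simp
    _ < ε := by linarith

end Rate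

/-! ### Limit laws of the two hyper-parameter estimators. -/

section Normality

variable {Ω : Type*} [MeasurableSpace Ω] {μ : Measure Ω} [IsProbabilityMeasure μ]
  {n : ℕ} {σ : ℝ} {φ : ℕ → Ω → Fin n → ℝ} {v : ℕ → Ω → ℝ} {Sig : Matrix (Fin n) (Fin n) ℝ}

lemma tendsto_probFilter_gram (hφ_meas : ∀ t, Measurable (φ t))
    (hconv : ∀ᵐ ω ∂μ, Tendsto (fun N => gram (fun t => φ t ω) N) atTop (𝓝 Sig)) :
    Tendsto (fun x : ℕ × Ω => gram (fun t => φ t x.2) x.1) (probFilter μ) (𝓝 Sig) :=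
  tendsto_probFilter_matrix (J := fun N ω => gram (fun t => φ t ω) N)
    (fun N i j => (measurable_gram_apply N i j).comp (measurable_regressors hφ_meas)) hconv

lemma tendsto_lsEstimator
    (hφ_meas : ∀ t, Measurable (φ t)) (hv_meas : ∀ t, Measurable (v t))
    (hv_law : ∀ t, μ.map (v t) = gaussianReal 0 (Real.toNNReal (σ ^ 2)))
    (hv_indep : iIndepFun v μ) (hφv : IndepFun (fun ω t => φ t ω) (fun ω t => v t ω) μ)
    (hSig : IsUnit Sig)
    (hconv : ∀ᵐ ω ∂μ, Tendsto (fun N => gram (fun t => φ t ω) N) atTop (𝓝 Sig))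
    (θ₀ : Fin n → ℝ) :
    Tendsto (fun x : ℕ × Ω => lsEstimator (regMatrix (fun t => φ t x.2) x.1)
      (outputVec (fun t => φ t x.2) (fun t => v t x.2) θ₀ x.1)) (probFilter μ) (𝓝 θ₀) := by
  have hq := tendsto_smul_scaledError_zero hφ_meas hv_meas hv_law hv_indep hφv hSig hconv
  have hs := tendsto_inv_sqrt_sqrt_nat.comp (tendsto_fst_probFilter (μ := μ))
  have h := (hs.smul hq).const_add θ₀
  rw [smul_zero, add_zero] at h
  refine h.congr' ?_
  filter_upwards [eventually_isUnit_of_tendsto hSig (tendsto_probFilter_gram hφ_meas hconv),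
    tendsto_fst_probFilter.eventually (eventually_gt_atTop 0)] with x hx1 hx2
  rw [lsEstimator_outputVec hx2 hx1]
  simp only [Function.comp_apply, smul_smul]
  rw [← mul_inv, Real.mul_self_sqrt (Real.sqrt_nonneg _)]

/-- Asymptotic linearity of an estimator that satisfies the error bound of a critical point. -/
lemma tendsto_sqrt_mul_sub_ratio
    (hφ_meas : ∀ t, Measurable (φ t)) (hv_meas : ∀ t, Measurable (v t))
    (hv_law : ∀ t, μ.map (v t) = gaussianReal 0 (Real.toNNReal (σ ^ 2)))
    (hv_indep : iIndepFun v μ) (hφv : IndepFun (fun ω t => φ t ω) (fun ω t => v t ω) μ)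
    (hSig : IsUnit Sig)
    (hconv : ∀ᵐ ω ∂μ, Tendsto (fun N => gram (fun t => φ t ω) N) atTop (𝓝 Sig))
    {θ₀ : Fin n → ℝ} {J : ℕ × Ω → Matrix (Fin n) (Fin n) ℝ} {J₀ : Matrix (Fin n) (Fin n) ℝ}
    (hJ : Tendsto J (probFilter μ) (𝓝 J₀)) (hT₀ : 0 < θ₀ ⬝ᵥ (J₀ *ᵥ θ₀))
    {η : ℕ × Ω → ℝ} {θ : ℕ × Ω → Fin n → ℝ}
    (hθ : θ = fun x : ℕ × Ω => lsEstimator (regMatrix (fun t => φ t x.2) x.1)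
      (outputVec (fun t => φ t x.2) (fun t => v t x.2) θ₀ x.1)) (k : ℕ) (C : ℝ)
    (hbound : ∀ B : ℝ, ∀ᶠ x in probFilter μ, 0 < x.1 → (gram (fun t => φ t x.2) x.1).PosDef →
      (gram (fun t => φ t x.2) x.1).trace ≤ B → (gram (fun t => φ t x.2) x.1)⁻¹.trace ≤ B →
      0 < θ x ⬝ᵥ (J x *ᵥ θ x) →
      2 * (B ^ 2) ^ k * (σ ^ 2 * B / x.1) * (J x).trace ≤ θ x ⬝ᵥ (J x *ᵥ θ x) →
      |η x - θ x ⬝ᵥ (J x *ᵥ θ x) / (J x).trace| ≤ C * (B ^ 2) ^ k * (σ ^ 2 * B / x.1)) :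
    Tendsto (fun x : ℕ × Ω => √(x.1 : ℝ) * (η x - θ x ⬝ᵥ (J x *ᵥ θ x) / (J x).trace))
      (probFilter μ) (𝓝 0) := by
  have hgl := tendsto_probFilter_gram hφ_meas hconv
  have hθl : Tendsto θ (probFilter μ) (𝓝 θ₀) :=
    hθ ▸ tendsto_lsEstimator hφ_meas hv_meas hv_law hv_indep hφv hSig hconv θ₀
  have hTl := tendsto_dotProduct hθl (tendsto_mulVec hJ hθl)
  -- Any `B` above both limiting traces bounds the empirical traces with probability tending to one.
  obtain ⟨B, hB1, hB2⟩ : ∃ B, Sig.trace < B ∧ Sig⁻¹.trace < B :=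
    ⟨max Sig.trace Sig⁻¹.trace + 1, by linarith [le_max_left Sig.trace Sig⁻¹.trace],
      by linarith [le_max_right Sig.trace Sig⁻¹.trace]⟩
  have hN : Tendsto (fun x : ℕ × Ω => (x.1 : ℝ)) (probFilter μ) atTop :=
    tendsto_natCast_atTop_atTop.comp tendsto_fst_probFilter
  have hsmall : Tendsto (fun x : ℕ × Ω => 2 * (B ^ 2) ^ k * (σ ^ 2 * B / x.1) * (J x).trace)
      (probFilter μ) (𝓝 0) := by
    simpa using ((hN.const_div_atTop (σ ^ 2 * B)).const_mul (2 * (B ^ 2) ^ k)).mul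
      (tendsto_trace hJ)
  have hlim : Tendsto (fun x : ℕ × Ω => C * (B ^ 2) ^ k * (σ ^ 2 * B) * (√(x.1 : ℝ))⁻¹)
      (probFilter μ) (𝓝 0) := by
    simpa using (tendsto_inv_atTop_zero.comp (Real.tendsto_sqrt_atTop.comp hN)).const_mul
      (C * (B ^ 2) ^ k * (σ ^ 2 * B))
  refine squeeze_zero_norm' ?_ hlim
  filter_upwards [hbound B, tendsto_fst_probFilter.eventually (eventually_gt_atTop 0),
    eventually_isUnit_of_tendsto hSig hgl,
    (tendsto_trace hgl).eventually_le_const hB1,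
    (tendsto_trace (tendsto_matrix_inv hSig hgl)).eventually_le_const hB2,
    hTl.eventually_const_lt hT₀, hsmall.eventually_lt hTl hT₀] with x h1 h2 h3 h4 h5 h6 h7
  have h := h1 h2 (gram_posDef h3) h4 h5 h6 h7.le
  have hN' : (0 : ℝ) < x.1 := by exact_mod_cast h2
  have hs : 0 < √(x.1 : ℝ) := Real.sqrt_pos.2 hN'
  rw [norm_mul, Real.norm_eq_abs, Real.norm_eq_abs, abs_of_pos hs]
  calc _ ≤ √(x.1 : ℝ) * (C * (B ^ 2) ^ k * (σ ^ 2 * B / x.1)) := by gcongr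
    _ = _ := by
      have : (x.1 : ℝ)⁻¹ = (√(x.1 : ℝ))⁻¹ * (√(x.1 : ℝ))⁻¹ := by
        rw [← mul_inv, Real.mul_self_sqrt hN'.le]
      rw [div_eq_mul_inv (σ ^ 2 * B), this]
      field_simp

theorem tendstoInDistribution_empiricalBayes (hn : 2 ≤ n) (hσ : 0 < σ)
    (hφ_meas : ∀ t, Measurable (φ t)) (hv_meas : ∀ t, Measurable (v t))
    (hv_law : ∀ t, μ.map (v t) = gaussianReal 0 (Real.toNNReal (σ ^ 2)))
    (hv_indep : iIndepFun v μ) (hφv : IndepFun (fun ω t => φ t ω) (fun ω t => v t ω) μ)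
    (hSig : Sig.PosDef)
    (hconv : ∀ᵐ ω ∂μ, Tendsto (fun N => gram (fun t => φ t ω) N) atTop (𝓝 Sig))
    {H : Set ℝ} (hH : IsOpen H) (hpos : ∀ x ∈ H, 0 < x) {θ₀ : Fin n → ℝ} {ηb : ℝ}
    {ηEB : ℕ → Ω → ℝ} (hb : IsArgmin (fun η => limitEB θ₀ (ridgeKernel n η)) H ηb)
    (hη : ∀ N, Measurable (ηEB N))
    (hmin : ∀ᶠ x : ℕ × Ω in probFilter μ, IsArgmin
      (fun η => costEB σ (regMatrix (fun t => φ t x.2) x.1)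
        (outputVec (fun t => φ t x.2) (fun t => v t x.2) θ₀ x.1) (ridgeKernel n η)) H
      (ηEB x.1 x.2)) :
    TendstoInDistribution (fun (N : ℕ) ω => √(N : ℝ) * (ηEB N ω - ηb)) atTop
      (id : ℝ → ℝ) (fun _ => μ) (gaussianReal 0 (Real.toNNReal (asympVarEB σ Sig θ₀))) := by
  have hcrit := limitEB_critical hH hpos hb
  have htr : 0 < (1 : Matrix (Fin n) (Fin n) ℝ).trace := by
    rw [trace_one, Fintype.card_fin]
    exact_mod_cast (by omega : 0 < n)
  -- A positive minimizer of the limit cost forces θ₀ᵀJ₀θ₀ > 0, hence θ₀ ≠ 0. The smallness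
  -- condition of the root bound relies on this.
  have hT₀ := mul_pos (hpos ηb hb.1) htr
  rw [← hcrit] at hT₀
  have hlin := tendsto_sqrt_mul_sub_ratio hφ_meas hv_meas hv_law hv_indep hφv hSig.isUnit hconv
    (J := fun _ => 1) (J₀ := 1) (θ₀ := θ₀) (η := fun x => ηEB x.1 x.2) tendsto_const_nhds hT₀ rfl 2
    (2 ^ 3 + 1) fun B => by
      filter_upwards [hmin] with x hx h1 h2 h3 h4 h5 h6
      exact abs_argmin_costEB_sub_le hσ hH hpos hx h1 h2 h3 h4 rfl h5 h6
  have hmain := tendstoInDistribution_of_quadratic_ratio hφ_meas hv_meas hv_law hv_indep hφv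
    hSig.isUnit hconv θ₀ (J := fun _ _ => 1) (J₀ := 1) (fun _ _ _ => measurable_const)
    (fun _ _ => transpose_one) (ae_of_all _ fun _ => tendsto_const_nhds)
    (by simpa using tendsto_const_nhds) htr.ne' hη hlin
  have hvar : σ ^ 2 * (((2 / (1 : Matrix (Fin n) (Fin n) ℝ).trace) •
      ((1 : Matrix (Fin n) (Fin n) ℝ) *ᵥ θ₀)) ⬝ᵥ (Sig⁻¹ *ᵥ
        ((2 / (1 : Matrix (Fin n) (Fin n) ℝ).trace) •
          ((1 : Matrix (Fin n) (Fin n) ℝ) *ᵥ θ₀)))) = asympVarEB σ Sig θ₀ := by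
    simp only [one_mulVec, mulVec_smul, smul_dotProduct, dotProduct_smul, smul_eq_mul, trace_one,
      Fintype.card_fin, asympVarEB]
    ring
  rw [hvar, hcrit, mul_div_cancel_right₀ _ htr.ne'] at hmain
  exact hmain

theorem tendstoInDistribution_sure (hn : 2 ≤ n) (hσ : 0 < σ)
    (hφ_meas : ∀ t, Measurable (φ t)) (hv_meas : ∀ t, Measurable (v t))
    (hv_law : ∀ t, μ.map (v t) = gaussianReal 0 (Real.toNNReal (σ ^ 2)))
    (hv_indep : iIndepFun v μ) (hφv : IndepFun (fun ω t => φ t ω) (fun ω t => v t ω) μ)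
    (hSig : Sig.PosDef)
    (hconv : ∀ᵐ ω ∂μ, Tendsto (fun N => gram (fun t => φ t ω) N) atTop (𝓝 Sig))
    {H : Set ℝ} (hH : IsOpen H) (hpos : ∀ x ∈ H, 0 < x) {θ₀ : Fin n → ℝ} {ηy : ℝ}
    {ηSy : ℕ → Ω → ℝ} {δ : ℕ → ℝ} (hδ : ∀ N, 0 < δ N)
    (hrate : IsBigOInProb μ (fun N ω => frobNorm (gram (fun t => φ t ω) N - Sig)) δ)
    (ho : δ =o[atTop] fun N : ℕ => 1 / √(N : ℝ))
    (hy : IsArgmin (fun η => limitSy σ Sig θ₀ (ridgeKernel n η)) H ηy)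
    (hη : ∀ N, Measurable (ηSy N))
    (hmin : ∀ᶠ x : ℕ × Ω in probFilter μ, IsArgmin
      (fun η => costSy σ (regMatrix (fun t => φ t x.2) x.1)
        (outputVec (fun t => φ t x.2) (fun t => v t x.2) θ₀ x.1) (ridgeKernel n η)) H
      (ηSy x.1 x.2)) :
    TendstoInDistribution (fun (N : ℕ) ω => √(N : ℝ) * (ηSy N ω - ηy)) atTop
      (id : ℝ → ℝ) (fun _ => μ) (gaussianReal 0 (Real.toNNReal (asympVarSy σ Sig θ₀))) := by
  have hcrit := limitSy_critical hσ hH hpos hy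
  have : Nonempty (Fin n) := ⟨⟨0, by omega⟩⟩
  have htr : 0 < Sig⁻¹.trace := hSig.inv.trace_pos
  have hT₀ := mul_pos (hpos ηy hy.1) htr
  rw [← hcrit] at hT₀
  have hgl := tendsto_probFilter_gram hφ_meas hconv
  have hdet : IsUnit Sig.det := (Matrix.isUnit_iff_isUnit_det _).1 hSig.isUnit
  have hlin := tendsto_sqrt_mul_sub_ratio hφ_meas hv_meas hv_law hv_indep hφv hSig.isUnit hconv
    (J := fun x => (gram (fun t => φ t x.2) x.1)⁻¹) (J₀ := Sig⁻¹) (θ₀ := θ₀)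
    (η := fun x => ηSy x.1 x.2) (tendsto_matrix_inv hSig.isUnit hgl) hT₀ rfl 3
    (2 ^ 4 + 1) fun B => by
      filter_upwards [hmin] with x hx h1 h2 h3 h4 h5 h6
      exact abs_argmin_costSy_sub_le hσ hH hpos hx h1 h2 h3 h4 rfl h5 h6
  have hfrob := tendsto_sqrt_mul_of_isBigOInProb hδ hrate ho
  have hgrate : Tendsto (fun x : ℕ × Ω => √(x.1 : ℝ) • (gram (fun t => φ t x.2) x.1 - Sig))
      (probFilter μ) (𝓝 0) := by
    refine tendsto_matrix_of_apply fun i j => squeeze_zero_norm (fun x => ?_) hfrob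
    rw [Matrix.smul_apply, smul_eq_mul, norm_mul, Real.norm_of_nonneg (Real.sqrt_nonneg _)]
    exact mul_le_mul_of_nonneg_left (abs_apply_le_frobNorm _ i j) (Real.sqrt_nonneg _)
  -- From G⁻¹ - Σ⁻¹ = -G⁻¹(G - Σ)Σ⁻¹, the rate of the Gram matrix passes to its inverse.
  have hJrate : Tendsto (fun x : ℕ × Ω => √(x.1 : ℝ) •
      ((gram (fun t => φ t x.2) x.1)⁻¹ - Sig⁻¹)) (probFilter μ) (𝓝 0) := by
    have hc : Continuous fun p : Matrix (Fin n) (Fin n) ℝ × Matrix (Fin n) (Fin n) ℝ =>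
        -(p.1 * p.2 * Sig⁻¹) :=
      ((continuous_fst.matrix_mul continuous_snd).matrix_mul continuous_const).neg
    have h := (hc.tendsto (Sig⁻¹, 0)).comp
      ((tendsto_matrix_inv hSig.isUnit hgl).prodMk_nhds hgrate)
    simp only [Matrix.mul_zero, Matrix.zero_mul, neg_zero] at h
    refine h.congr' ?_
    filter_upwards [eventually_isUnit_of_tendsto hSig.isUnit hgl] with x hx
    have hxd : IsUnit (gram (fun t => φ t x.2) x.1).det := (Matrix.isUnit_iff_isUnit_det _).1 hx
    simp only [Function.comp_apply]
    rw [Matrix.mul_smul, Matrix.smul_mul, ← smul_neg, Matrix.mul_sub, Matrix.sub_mul,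
      Matrix.nonsing_inv_mul _ hxd, Matrix.one_mul, Matrix.mul_assoc,
      Matrix.mul_nonsing_inv _ hdet, Matrix.mul_one, neg_sub]
  have hmain := tendstoInDistribution_of_quadratic_ratio hφ_meas hv_meas hv_law hv_indep hφv
    hSig.isUnit hconv θ₀ (J := fun N f => (gram f N)⁻¹) (J₀ := Sig⁻¹)
    (fun N i j => measurable_matrix_inv_apply (fun i j => measurable_gram_apply N i j) i j)
    (fun N f => gram_inv_transpose f N)
    (by filter_upwards [hconv] with ω hω using tendsto_matrix_inv hSig.isUnit hω)
    hJrate htr.ne' hη hlin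
  have hsymm : (Sig⁻¹)ᵀ = Sig⁻¹ := by
    have := hSig.inv.isHermitian
    rwa [Matrix.IsHermitian, conjTranspose_eq_transpose_of_trivial] at this
  have hvar : σ ^ 2 * (((2 / Sig⁻¹.trace) • (Sig⁻¹ *ᵥ θ₀)) ⬝ᵥ (Sig⁻¹ *ᵥ
      ((2 / Sig⁻¹.trace) • (Sig⁻¹ *ᵥ θ₀)))) = asympVarSy σ Sig θ₀ := by
    have h3 : (Sig⁻¹ *ᵥ θ₀) ⬝ᵥ (Sig⁻¹ *ᵥ (Sig⁻¹ *ᵥ θ₀)) = θ₀ ⬝ᵥ ((Sig⁻¹ ^ 3) *ᵥ θ₀) := by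
      have hv : Sig⁻¹ *ᵥ θ₀ = θ₀ ᵥ* Sig⁻¹ := by rw [← mulVec_transpose, hsymm]
      calc _ = (θ₀ ᵥ* Sig⁻¹) ⬝ᵥ (Sig⁻¹ *ᵥ (Sig⁻¹ *ᵥ θ₀)) := by rw [← hv]
        _ = _ := by
          rw [← dotProduct_mulVec, mulVec_mulVec, mulVec_mulVec, pow_succ, sq, Matrix.mul_assoc]
    simp only [mulVec_smul, smul_dotProduct, dotProduct_smul, smul_eq_mul, asympVarSy, h3]
    ring
  rw [hvar, hcrit, mul_div_cancel_right₀ _ htr.ne'] at hmain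
  exact hmain

end Normality

/-! ### The variance ratio as the smallest eigenvalue vanishes. -/

section EigenvalueLimit

variable {n : ℕ}

lemma exists_eq_specMatrix_sortedEig {A : Matrix (Fin n) (Fin n) ℝ} (hA : A.IsHermitian) :
    ∃ U : Matrix (Fin n) (Fin n) ℝ, U * Uᵀ = 1 ∧ Uᵀ * U = 1 ∧ A = specMatrix U (sortedEig hA) := by
  -- `eigenvalues` is indexed through an unspecified equivalence. Permuting the eigenvector columns
  -- by `e` puts them in decreasing order of eigenvalue.
  set e : Fin n ≃ Fin n := ((finCongr (Fintype.card_fin n)).symm.trans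
    (Fintype.equivOfCardEq (Fintype.card_fin (Fintype.card (Fin n))))) with he
  set V : Matrix (Fin n) (Fin n) ℝ := hA.eigenvectorUnitary.1
  have h1 : V * Vᵀ = 1 := by
    have := Unitary.coe_mul_star_self hA.eigenvectorUnitary
    rwa [Unitary.coe_star, star_eq_conjTranspose, conjTranspose_eq_transpose_of_trivial] at this
  have h2 : Vᵀ * V = 1 := by
    have := Unitary.coe_star_mul_self hA.eigenvectorUnitary
    rwa [star_eq_conjTranspose, conjTranspose_eq_transpose_of_trivial] at this
  have h3 : A = V * diagonal hA.eigenvalues * Vᵀ := by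
    have h := hA.spectral_theorem
    rw [Unitary.conjStarAlgAut_apply, star_eq_conjTranspose,
      conjTranspose_eq_transpose_of_trivial] at h
    exact h
  have hd : diagonal (sortedEig hA) = (diagonal hA.eigenvalues).submatrix e e := by
    rw [submatrix_diagonal_equiv]
    congr 1
    ext i
    simp [he, sortedEig, Matrix.IsHermitian.eigenvalues]
  refine ⟨V.submatrix id e, ?_, ?_, ?_⟩
  · rw [transpose_submatrix, submatrix_mul_equiv, h1, submatrix_id_id]
  · rw [transpose_submatrix, ← submatrix_mul _ _ _ _ _ Function.bijective_id, h2,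
      submatrix_one_equiv]
  · rw [specMatrix, hd, transpose_submatrix, submatrix_mul_equiv, submatrix_mul_equiv, ← h3,
      submatrix_id_id]

variable {U : Matrix (Fin n) (Fin n) ℝ} {m : Fin n → ℝ} {θ : Fin n → ℝ}

lemma asympVarEB_specMatrix (hU : U * Uᵀ = 1) (hU' : Uᵀ * U = 1) (hm : ∀ i, 0 < m i) (σ : ℝ) :
    asympVarEB σ (specMatrix U m) θ =
      4 * σ ^ 2 / (n : ℝ) ^ 2 * ∑ i, (m i)⁻¹ * (Uᵀ *ᵥ θ) i ^ 2 := by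
  rw [asympVarEB, specMatrix_inv hU hU' fun i => (hm i).ne', dotProduct_specMatrix_mulVec]
  rfl

lemma asympVarSy_specMatrix (hU : U * Uᵀ = 1) (hU' : Uᵀ * U = 1) (hm : ∀ i, 0 < m i) (σ : ℝ) :
    asympVarSy σ (specMatrix U m) θ =
      4 * σ ^ 2 / (∑ i, (m i)⁻¹) ^ 2 * ∑ i, (m i)⁻¹ ^ 3 * (Uᵀ *ᵥ θ) i ^ 2 := by
  have h3 : specMatrix U m⁻¹ ^ 3 = specMatrix U (m⁻¹ * m⁻¹ * m⁻¹) := by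
    rw [pow_succ, sq, specMatrix_mul hU', specMatrix_mul hU']
  rw [asympVarSy, specMatrix_inv hU hU' fun i => (hm i).ne', trace_specMatrix hU', h3,
    dotProduct_specMatrix_mulVec]
  congr 1
  refine Finset.sum_congr rfl fun i _ => ?_
  simp only [Pi.mul_apply, Pi.inv_apply]
  ring

lemma sum_sq_transpose_mulVec (hU : U * Uᵀ = 1) (x : Fin n → ℝ) :
    ∑ i, (Uᵀ *ᵥ x) i ^ 2 = x ⬝ᵥ x := by
  have h := dotProduct_specMatrix_mulVec (U := U) 1 x
  rw [specMatrix_one hU, one_mulVec] at h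
  rw [h]
  simp

/-- A unit eigenvector of a simple eigenvalue gives the squared coordinate along it. -/
lemma sq_dotProduct_eigenvector (hU : U * Uᵀ = 1) (hU' : Uᵀ * U = 1) {u : Fin n → ℝ}
    (hu : u ⬝ᵥ u = 1) {j : Fin n} (hj : specMatrix U m *ᵥ u = m j • u)
    (hsep : ∀ i, i ≠ j → m i ≠ m j) : (u ⬝ᵥ θ) ^ 2 = (Uᵀ *ᵥ θ) j ^ 2 := by
  have h0 : ∀ i, i ≠ j → (Uᵀ *ᵥ u) i = 0 := fun i hi => by
    have h := transpose_mulVec_specMatrix_mulVec hU' m u i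
    rw [hj, mulVec_smul, Pi.smul_apply, smul_eq_mul] at h
    have h' : (m j - m i) * (Uᵀ *ᵥ u) i = 0 := by linarith
    exact (mul_eq_zero.1 h').resolve_left (sub_ne_zero.2 (hsep i hi).symm)
  have h1 : (Uᵀ *ᵥ u) j ^ 2 = 1 := by
    rw [← hu, ← sum_sq_transpose_mulVec hU u]
    rw [Finset.sum_eq_single j (fun i _ hi => by rw [h0 i hi, sq, zero_mul])
      fun h => absurd (Finset.mem_univ j) h]
  have h2 : u ⬝ᵥ θ = (Uᵀ *ᵥ u) j * (Uᵀ *ᵥ θ) j := by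
    have h3 : u ⬝ᵥ θ = (Uᵀ *ᵥ u) ⬝ᵥ (Uᵀ *ᵥ θ) := by
      rw [dotProduct_mulVec, ← mulVec_transpose, transpose_transpose, mulVec_mulVec, hU,
        one_mulVec]
    rw [h3, dotProduct]
    refine Finset.sum_eq_single j (fun i _ hi => ?_) fun h => absurd (Finset.mem_univ j) h
    rw [h0 i hi, zero_mul]
  rw [h2, mul_pow, h1, one_mul]

/-- When one eigenvalue `m k j` tends to zero and the others are fixed, a weighted spectral sum of
bounded coordinates is dominated by the `j`-th term. -/
lemma tendsto_spectral_sum_sub {m z : ℕ → Fin n → ℝ} {j : Fin n} {T : ℝ} {p : ℕ} (hp : p ≠ 0)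
    (hm : ∀ k i, 0 < m k i) (hfix : ∀ k i, i ≠ j → m k i = m 0 i)
    (hlim : Tendsto (fun k => m k j) atTop (𝓝 0)) (hz : ∀ k i, 0 ≤ z k i)
    (hzT : ∀ k i, z k i ≤ T) :
    Tendsto (fun k => m k j ^ p * ∑ i, (m k i)⁻¹ ^ p * z k i - z k j) atTop (𝓝 0) := by
  have hpow : Tendsto (fun k => m k j ^ p) atTop (𝓝 0) := by
    simpa [hp] using hlim.pow p
  have hb : Tendsto (fun k => m k j ^ p * ∑ i, (m 0 i)⁻¹ ^ p * T) atTop (𝓝 0) := by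
    simpa using hpow.mul_const (∑ i, (m 0 i)⁻¹ ^ p * T)
  have hsplit : ∀ k, m k j ^ p * ∑ i, (m k i)⁻¹ ^ p * z k i - z k j =
      m k j ^ p * ∑ i ∈ Finset.univ.erase j, (m k i)⁻¹ ^ p * z k i := fun k => by
    rw [← Finset.add_sum_erase _ _ (Finset.mem_univ j), mul_add, ← mul_assoc, ← mul_pow,
      mul_inv_cancel₀ (hm k j).ne', one_pow, one_mul, add_sub_cancel_left]
  have hinv : ∀ k i, 0 ≤ (m k i)⁻¹ ^ p := fun k i => pow_nonneg (inv_nonneg.2 (hm k i).le) _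
  refine squeeze_zero (fun k => ?_) (fun k => ?_) hb
  · rw [hsplit]
    exact mul_nonneg (pow_nonneg (hm k j).le _)
      (Finset.sum_nonneg fun i _ => mul_nonneg (hinv k i) (hz k i))
  · rw [hsplit]
    refine mul_le_mul_of_nonneg_left ?_ (pow_nonneg (hm k j).le _)
    calc ∑ i ∈ Finset.univ.erase j, (m k i)⁻¹ ^ p * z k i
        ≤ ∑ i ∈ Finset.univ.erase j, (m 0 i)⁻¹ ^ p * T := Finset.sum_le_sum fun i hi => by
          rw [hfix k i (Finset.ne_of_mem_erase hi)]
          exact mul_le_mul_of_nonneg_left (hzT k i) (hinv 0 i)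
      _ ≤ _ := Finset.sum_le_sum_of_subset_of_nonneg (Finset.erase_subset _ _) fun i _ _ =>
          mul_nonneg (hinv 0 i) ((hz 0 i).trans (hzT 0 i))

/-- With a = λₙ θ₀ᵀΣ⁻¹θ₀, b = λₙ Tr Σ⁻¹ and d = λₙ³ θ₀ᵀΣ⁻³θ₀ the ratio is (a/d) b²/n². The
eigenvectors may vary, so a and d need not converge. It suffices that a - d → 0, d is bounded below
and b → 1. -/
theorem tendsto_asympVar_ratio (hn : 2 ≤ n) (h0n : 0 < n) (hlast : n - 1 < n) {σ : ℝ}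
    (hσ : 0 < σ) (θ₀ : Fin n → ℝ) (S : ℕ → Matrix (Fin n) (Fin n) ℝ) (hS : ∀ k, (S k).PosDef) (u : ℕ → Fin n → ℝ) (c : ℝ)
    (hfix : ∀ k, ∀ i : Fin n, (i : ℕ) < n - 1 →
      sortedEig (hS k).isHermitian i = sortedEig (hS 0).isHermitian i)
    (hlim : Tendsto (fun k => sortedEig (hS k).isHermitian ⟨n - 1, hlast⟩) atTop (𝓝 0))
    (hu : ∀ k, u k ⬝ᵥ u k = 1)
    (heig : ∀ k, S k *ᵥ u k = sortedEig (hS k).isHermitian ⟨n - 1, hlast⟩ • u k)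
    (hc : 0 < c) (hcu : ∀ k, c ≤ |u k ⬝ᵥ θ₀|) :
    Tendsto (fun k => sortedEig (hS k).isHermitian ⟨0, h0n⟩ /
        sortedEig (hS k).isHermitian ⟨n - 1, hlast⟩) atTop atTop ∧
      Tendsto (fun k => asympVarEB σ (S k) θ₀ / asympVarSy σ (S k) θ₀) atTop
        (𝓝 (1 / (n : ℝ) ^ 2)) := by
  choose U hU hU' hSU using fun k => exists_eq_specMatrix_sortedEig (hS k).isHermitian
  set m : ℕ → Fin n → ℝ := fun k => sortedEig (hS k).isHermitian
  have hm : ∀ k i, 0 < m k i := fun k i => by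
    have := (hS k).eigenvalues_pos
      ((Fintype.equivOfCardEq (Fintype.card_fin _)) (Fin.cast (Fintype.card_fin n).symm i))
    simpa [m, sortedEig, Matrix.IsHermitian.eigenvalues] using this
  set j : Fin n := ⟨n - 1, hlast⟩
  have hfix' : ∀ k i, i ≠ j → m k i = m 0 i := fun k i hi => hfix k i (by
    have h1 := i.isLt
    have h2 : (i : ℕ) ≠ n - 1 := fun h => hi (Fin.ext h)
    omega)
  set z : ℕ → Fin n → ℝ := fun k i => ((U k)ᵀ *ᵥ θ₀) i ^ 2
  have hz : ∀ k i, 0 ≤ z k i := fun k i => sq_nonneg _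
  have hzT : ∀ k i, z k i ≤ θ₀ ⬝ᵥ θ₀ := fun k i => by
    rw [← sum_sq_transpose_mulVec (hU k) θ₀]
    exact Finset.single_le_sum (f := z k) (fun i _ => hz k i) (Finset.mem_univ i)
  constructor
  -- Because n ≥ 2, the index 0 is among the fixed eigenvalues.
  · have h0 : ∀ k, m k ⟨0, h0n⟩ = m 0 ⟨0, h0n⟩ := fun k =>
      hfix k _ (by simp only; omega)
    have hinv : Tendsto (fun k => (m k j)⁻¹) atTop atTop :=
      tendsto_inv_nhdsGT_zero.comp
        (tendsto_nhdsWithin_iff.2 ⟨hlim, Eventually.of_forall fun k => hm k j⟩)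
    refine (hinv.const_mul_atTop (hm 0 ⟨0, h0n⟩)).congr fun k => ?_
    change _ = m k _ / m k j
    rw [h0 k, div_eq_mul_inv]
  · have hA := tendsto_spectral_sum_sub one_ne_zero hm hfix' hlim hz hzT
    have hB := tendsto_spectral_sum_sub (z := fun _ _ => 1) (T := 1) one_ne_zero hm hfix' hlim
      (fun _ _ => zero_le_one) (fun _ _ => le_rfl)
    have hC := tendsto_spectral_sum_sub (p := 3) three_ne_zero hm hfix' hlim hz hzT
    simp only [pow_one, mul_one] at hA hB
    have hB1 := hB.add_const 1
    simp only [sub_add_cancel, zero_add] at hB1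
    -- Once λₙ is below all the fixed eigenvalues it is simple, so `u k` agrees up to sign with the
    -- last column of `U k` and the lower bound `c` transfers.
    have hzj : ∀ᶠ k in atTop, c ^ 2 ≤ z k j := by
      have hsep : ∀ᶠ k in atTop, ∀ i, m k j < m 0 i :=
        eventually_all.2 fun i => hlim.eventually_lt_const (hm 0 i)
      filter_upwards [hsep] with k hk
      have h := sq_dotProduct_eigenvector (θ := θ₀) (hU k) (hU' k) (hu k) (j := j)
        (by rw [← hSU]; exact heig k) fun i hi => by
          change m k i ≠ m k j
          rw [hfix' k i hi]
          exact (hk i).ne'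
      change _ ≤ ((U k)ᵀ *ᵥ θ₀) j ^ 2
      rw [← h, ← sq_abs (u k ⬝ᵥ θ₀)]
      exact pow_le_pow_left₀ hc.le (hcu k) 2
    set a : ℕ → ℝ := fun k => m k j * ∑ i, (m k i)⁻¹ * z k i
    set b : ℕ → ℝ := fun k => m k j * ∑ i, (m k i)⁻¹
    set d : ℕ → ℝ := fun k => m k j ^ 3 * ∑ i, (m k i)⁻¹ ^ 3 * z k i
    have hd : ∀ᶠ k in atTop, c ^ 2 ≤ d k := by
      filter_upwards [hzj] with k hk
      refine hk.trans ?_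
      have h : (m k j)⁻¹ ^ 3 * z k j ≤ ∑ i, (m k i)⁻¹ ^ 3 * z k i :=
        Finset.single_le_sum (f := fun i => (m k i)⁻¹ ^ 3 * z k i)
          (fun i _ => mul_nonneg (pow_nonneg (inv_nonneg.2 (hm k i).le) _) (hz k i))
          (Finset.mem_univ j)
      calc z k j = m k j ^ 3 * ((m k j)⁻¹ ^ 3 * z k j) := by
            have := (hm k j).ne'
            field_simp
        _ ≤ _ := mul_le_mul_of_nonneg_left h (pow_nonneg (hm k j).le _)
    -- Both a and d differ from the same z k j by a vanishing amount.
    have had : Tendsto (fun k => a k - d k) atTop (𝓝 0) := by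
      have h := hA.sub hC
      rw [sub_zero] at h
      exact h.congr fun k => sub_sub_sub_cancel_right _ _ _
    have hc2 : 0 < c ^ 2 := by positivity
    have hratio : Tendsto (fun k => a k / d k) atTop (𝓝 1) := by
      rw [tendsto_iff_norm_sub_tendsto_zero]
      have hb := had.norm.mul_const (c ^ 2)⁻¹
      rw [norm_zero, zero_mul] at hb
      refine squeeze_zero' (Eventually.of_forall fun _ => norm_nonneg _) ?_ hb
      filter_upwards [hd] with k hk
      have hdk := hc2.trans_le hk
      rw [show a k / d k - 1 = (a k - d k) * (d k)⁻¹ by field_simp, norm_mul, norm_inv,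
        Real.norm_of_nonneg hdk.le]
      gcongr
    have hmain := (hratio.mul (hB1.pow 2)).div_const ((n : ℝ) ^ 2)
    rw [one_pow, mul_one] at hmain
    refine hmain.congr' ?_
    filter_upwards [hd] with k hk
    have hdk := hc2.trans_le hk
    rw [hSU k, asympVarEB_specMatrix (hU k) (hU' k) (hm k),
      asympVarSy_specMatrix (hU k) (hU' k) (hm k)]
    change a k / d k * b k ^ 2 / (n : ℝ) ^ 2 = 4 * σ ^ 2 / (n : ℝ) ^ 2 *
      (∑ i, (m k i)⁻¹ * z k i) / (4 * σ ^ 2 / (∑ i, (m k i)⁻¹) ^ 2 * ∑ i, (m k i)⁻¹ ^ 3 * z k i)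
    simp only [a, b, d] at hdk ⊢
    have hmj := hm k j
    have hD : 0 < ∑ i, (m k i)⁻¹ ^ 3 * z k i := pos_of_mul_pos_right hdk (by positivity)
    have hb : 0 < ∑ i, (m k i)⁻¹ :=
      Finset.sum_pos (fun i _ => inv_pos.2 (hm k i)) ⟨j, Finset.mem_univ j⟩
    have hn' : (0 : ℝ) < n := by exact_mod_cast h0n
    generalize (∑ i, (m k i)⁻¹ ^ 3 * z k i) = D at hD ⊢
    generalize (∑ i, (m k i)⁻¹) = E at hb ⊢
    field_simp

end EigenvalueLimit

end RidgeAsymptotics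

theorem corollary1 {Ω : Type*} [MeasurableSpace Ω] (μ : Measure Ω) [IsProbabilityMeasure μ]
    (n : ℕ) (hn : 2 ≤ n) (σ : ℝ) (hσ : 0 < σ) (θ₀ : Fin n → ℝ)
    -- regressors and noise
    (φ : ℕ → Ω → Fin n → ℝ) (v : ℕ → Ω → ℝ)
    (hφ_meas : ∀ t, Measurable (φ t)) (hv_meas : ∀ t, Measurable (v t))
    (hv_law : ∀ t, μ.map (v t) = gaussianReal 0 (Real.toNNReal (σ ^ 2)))
    (hv_indep : iIndepFun v μ)
    (hφv : IndepFun (fun ω t => φ t ω) (fun ω t => v t ω) μ)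
    -- almost sure convergence of `ΦᵀΦ / N` to a positive definite matrix
    (Sig : Matrix (Fin n) (Fin n) ℝ) (hSig : Sig.PosDef)
    (hconv : ∀ᵐ ω ∂μ, Tendsto
      (fun N : ℕ => (N : ℝ)⁻¹ • ((RidgeAsymptotics.regMatrix (fun t => φ t ω) N)ᵀ *
        RidgeAsymptotics.regMatrix (fun t => φ t ω) N)) atTop (𝓝 Sig))
    -- the hyper-parameter set; `η I_n` is positive definite on it
    (H : Set ℝ) (hH_open : IsOpen H) (hH_pos : ∀ η ∈ H, 0 < η) :
    -- asymptotic normality of the empirical Bayes hyper-parameter estimator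
    (∀ (ηb : ℝ) (ηEB : ℕ → Ω → ℝ),
      RidgeAsymptotics.IsArgmin
        (fun η => RidgeAsymptotics.limitEB θ₀ (RidgeAsymptotics.ridgeKernel n η)) H ηb →
      (∀ N, Measurable (ηEB N)) →
      Tendsto (fun N : ℕ => μ {ω | ¬ RidgeAsymptotics.IsArgmin
        (fun η => RidgeAsymptotics.costEB σ (RidgeAsymptotics.regMatrix (fun t => φ t ω) N)
          (RidgeAsymptotics.outputVec (fun t => φ t ω) (fun t => v t ω) θ₀ N)
          (RidgeAsymptotics.ridgeKernel n η)) H (ηEB N ω)}) atTop (𝓝 0) →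
      TendstoInDistribution (fun (N : ℕ) ω => Real.sqrt N * (ηEB N ω - ηb)) atTop
        (id : ℝ → ℝ) (fun _ => μ)
        (gaussianReal 0 (Real.toNNReal (RidgeAsymptotics.asympVarEB σ Sig θ₀)))) ∧
    -- asymptotic normality of the `SURE_y` hyper-parameter estimator
    (∀ (ηy : ℝ) (ηSy : ℕ → Ω → ℝ) (δ : ℕ → ℝ),
      (∀ N, 0 < δ N) →
      RidgeAsymptotics.IsBigOInProb μ
        (fun N ω => RidgeAsymptotics.frobNorm
          ((N : ℝ)⁻¹ • ((RidgeAsymptotics.regMatrix (fun t => φ t ω) N)ᵀ *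
            RidgeAsymptotics.regMatrix (fun t => φ t ω) N) - Sig)) δ →
      δ =o[atTop] (fun N : ℕ => 1 / Real.sqrt N) →
      RidgeAsymptotics.IsArgmin
        (fun η => RidgeAsymptotics.limitSy σ Sig θ₀ (RidgeAsymptotics.ridgeKernel n η)) H ηy →
      (∀ N, Measurable (ηSy N)) →
      Tendsto (fun N : ℕ => μ {ω | ¬ RidgeAsymptotics.IsArgmin
        (fun η => RidgeAsymptotics.costSy σ (RidgeAsymptotics.regMatrix (fun t => φ t ω) N)
          (RidgeAsymptotics.outputVec (fun t => φ t ω) (fun t => v t ω) θ₀ N)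
          (RidgeAsymptotics.ridgeKernel n η)) H (ηSy N ω)}) atTop (𝓝 0) →
      TendstoInDistribution (fun (N : ℕ) ω => Real.sqrt N * (ηSy N ω - ηy)) atTop
        (id : ℝ → ℝ) (fun _ => μ)
        (gaussianReal 0 (Real.toNNReal (RidgeAsymptotics.asympVarSy σ Sig θ₀)))) ∧
    -- the ratio of the two asymptotic variances as `λ_n → 0` with `λ_1, …, λ_{n-1}` fixed
    (∀ (S : ℕ → Matrix (Fin n) (Fin n) ℝ) (hS : ∀ k, (S k).PosDef)
      (u : ℕ → Fin n → ℝ) (c : ℝ),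
      (∀ k, ∀ i : Fin n, (i : ℕ) < n - 1 →
        RidgeAsymptotics.sortedEig (hS k).isHermitian i =
          RidgeAsymptotics.sortedEig (hS 0).isHermitian i) →
      Tendsto (fun k => RidgeAsymptotics.sortedEig (hS k).isHermitian ⟨n - 1, by omega⟩)
        atTop (𝓝 0) →
      -- `u k` is a unit eigenvector for `λ_n`, and its inner product with `θ₀` stays away from `0`
      (∀ k, u k ⬝ᵥ u k = 1) →
      (∀ k, S k *ᵥ u k =
        RidgeAsymptotics.sortedEig (hS k).isHermitian ⟨n - 1, by omega⟩ • u k) →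
      0 < c → (∀ k, c ≤ |u k ⬝ᵥ θ₀|) →
      Tendsto (fun k => RidgeAsymptotics.sortedEig (hS k).isHermitian ⟨0, by omega⟩ /
        RidgeAsymptotics.sortedEig (hS k).isHermitian ⟨n - 1, by omega⟩) atTop atTop ∧
      Tendsto (fun k => RidgeAsymptotics.asympVarEB σ (S k) θ₀ /
        RidgeAsymptotics.asympVarSy σ (S k) θ₀) atTop (𝓝 (1 / (n : ℝ) ^ 2))) := by
  refine ⟨fun ηb ηEB hb hη hmin => ?_, fun ηy ηSy δ hδ hrate ho hy hη hmin => ?_,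
    fun S hS u c hfix hlim hu heig hc hcu => ?_⟩
  · exact RidgeAsymptotics.tendstoInDistribution_empiricalBayes hn hσ hφ_meas hv_meas hv_law
      hv_indep hφv hSig hconv hH_open hH_pos hb hη hmin
  · exact RidgeAsymptotics.tendstoInDistribution_sure hn hσ hφ_meas hv_meas hv_law hv_indep hφv
      hSig hconv hH_open hH_pos hδ hrate ho hy hη hmin
  · exact RidgeAsymptotics.tendsto_asympVar_ratio hn _ _ hσ θ₀ S hS u c hfix hlim hu heig hc hcu
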